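/- **Setting.** Let $(\mathbb X,\rho)$ be a quasi-metric space with its induced topology ($\rho\ge 0$, $\rho(x,y)=0$ iff $x=y$, $\rho$ is symmetric, $\rho(x,z)\le A(\rho(x,y)+\rho(y,z))$), $\mu$ a Borel probability measure on $\mathbb X$, $(\varphi_k)_{k\ge0}$ an orthonormal basis of the real space $L_2(\mathbb X,\mu)$ of continuous real functions with $\varphi_0\equiv1$, and $0=\lambda_0\le\lambda_1\le\dots$ with $\lambda_k\to\infty$. Let $\alpha>0$ and put $G_t(x,y)=\sum_k e^{-\lambda_k^2t}\varphi_k(x)\varphi_k(y)$. Assume that $\mathbb X$ is a diffusion measure space: all closed balls $B_t(x)$, $t>0$, are compact; $\mu(B_t(x))\lesssim t^\alpha$ for all $x$ and $t>0$; for some $c'>0$, $|G_t(x,y)|\lesssim t^{-\alpha/2}\exp(-c'\rho(x,y)^2/t)$ for all $x,y$ and $0<t\le1$; and $t^{-\alpha/2}\lesssim G_t(x,x)$ for all $x$ and $0<t<1$. Throughout, $N$ ranges over the powers $2^n$, $n=0,1,2,\dots$. For real $L$ let $\Pi_L=\operatorname{span}\{\varphi_k:\lambda_k\le L\}$. Assume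 that there is a constant $a>0$, fixed from now on, with $fg\in\Pi_{aN}$ for all $N$ and all $f,g\in\Pi_N$. A finite signed Borel measure $\nu$ is a *quadrature measure of order $M$* if $\int f\,d\nu=\int f\,d\mu$ for all $f\in\Pi_{aM}$. Fix an exponent $q\in[1,\infty)$. A family $(\nu_N)$ of finite signed Borel measures is a *uniform family of Marcinkiewicz–Zygmund (MZ) measures* of order $N$ if there are constants $A,B>0$ with $A\|f\|_{L_q(\mu)}\le\|f\|_{L_q(|\nu_N|)}\le B\|f\|_{L_q(\mu)}$ for all $N$ and all $f\in\Pi_{aN}$. Let $H:[0,\infty)\to\mathbb R$ be $C^\infty$ and non-increasing with $H=1$ on $[0,1/2]$ and $H=0$ on $[1,\infty)$. Let $1\le p\le\infty$. If $p<\infty$, put $\mu_N=\mu$ for all $N$. If $p=\infty$, let $(\mu_N)$ be a uniform family of MZ measures of order $N$ such that each $\mu_N$ is a quadrature measure of order $N$. Let $(\nu_N)$ be a uniform family of MZ measures of order $N$ such that each $\nu_N$ is a quadrature measure of order $2N$, with finite supports satisfying $\#\operatorname{supp}\nu_N\lesssim N^\alpha$. Let $s>0$ and $S>\max(1,s)$.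 For $r>0$ let $\overline{W^s_r}$ be the set of all $f\in L_p(\mu)$ with $$\|f\|_{L_p(\mu)}+\sup_N N^s\inf_{g\in\Pi_N}\|f-g\|_{L_p(\mu)}\le r,$$ where for $p=\infty$ each $f$ is represented by its continuous representative. Define $$\sigma_N(f,\mu_N,y)=\sum_kH\Big(\frac{\lambda_k}N\Big)\int f\varphi_k\,d\mu_N\;\varphi_k(y),\qquad I_N(f,\mu_N,y)=\lfloor N^S\sigma_N(f,\mu_N,y)\rfloor,$$ $$\sigma_N^\circ(f,\mu_N,\nu_N)=N^{-S}\sum_kH\Big(\frac{\lambda_k}{2N}\Big)\int I_N(f,\mu_N,y)\varphi_k(y)\,d\nu_N(y)\;\varphi_k .$$ **Theorem 5.1.** Let $r_0>0$. There are constants $c,C>0$, depending on $r_0$ and on the data above but not on $r$, $N$ or $f$, such that for all $r\ge r_0$ and all $N=2^n$ the following holds. 1. For all $f\in\overline{W^s_r}$, $\ \|f-\sigma^\circ_N(f,\mu_N,\nu_N)\|_{L_p(\mu)}\le c\,r\,N^{-s}$. 2. If $\varepsilon=c\,r\,N^{-s}$ satisfies $\varepsilon\le1$ and $\varepsilon\le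 r$, then the number of bits needed to represent all integers $I_N(f,\mu_N,y)$, $y\in\operatorname{supp}\nu_N$, of an arbitrary $f\in\overline{W^s_r}$, in signed binary with one common word length, is at most $C\,(r/\varepsilon)^{\alpha/s}\,(1+\log_2(r/\varepsilon))$. -/

import Mathlib

open MeasureTheory Filter Topology
open scoped ENNReal

noncomputable section

namespace DiffusionQuantization

variable {X : Type*}

/-- `ρ` is a quasi-metric on `X` which induces the topology of `X`: the balls around a point form
a neighbourhood basis of it. -/
structure IsQuasiMetric [TopologicalSpace X] (ρ : X → X → ℝ) : Prop where
  nonneg : ∀ x y, 0 ≤ ρ x y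
  eq_zero_iff : ∀ x y, ρ x y = 0 ↔ x = y
  symm : ∀ x y, ρ x y = ρ y x
  quasi_triangle : ∃ A : ℝ, ∀ x y z, ρ x z ≤ A * (ρ x y + ρ y z)
  nhds_basis : ∀ x, (𝓝 x).HasBasis (fun t : ℝ => 0 < t) (fun t => {y | ρ x y < t})

/-- An orthonormal basis `φ` of `L₂(μ)` consisting of continuous functions with `φ₀ ≡ 1`, together
with a nondecreasing sequence `lam` of real numbers with `lam 0 = 0` and `lam k → ∞`. -/
structure IsSpectralSystem [TopologicalSpace X] [MeasurableSpace X] (μ : Measure X)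
    (φ : ℕ → X → ℝ) (lam : ℕ → ℝ) : Prop where
  continuous : ∀ k, Continuous (φ k)
  memLp : ∀ k, MemLp (φ k) 2 μ
  orthonormal : Orthonormal ℝ (fun k => (memLp k).toLp (φ k))
  complete : (Submodule.span ℝ (Set.range fun k => (memLp k).toLp (φ k))).topologicalClosure = ⊤
  phi_zero : ∀ x, φ 0 x = 1
  lam_mono : Monotone lam
  lam_zero : lam 0 = 0
  lam_tendsto : Tendsto lam atTop atTop

/-- The generalized heat kernel `G_t(x,y) = ∑ₖ exp(-λₖ² t) φₖ(x) φₖ(y)`. -/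
def heatKernel (φ : ℕ → X → ℝ) (lam : ℕ → ℝ) (t : ℝ) (x y : X) : ℝ :=
  ∑' k, Real.exp (-(lam k) ^ 2 * t) * φ k x * φ k y

/-- Diffusion measure space of dimension `α`. The on-diagonal lower bound forces the series of the
heat kernel to converge (a divergent `tsum` would be `0`), on the diagonal for `0 < t < 1` and hence,
by the Cauchy-Schwarz inequality, absolutely for all `x`, `y` and `t > 0`. -/
structure IsDiffusionMeasureSpace [TopologicalSpace X] [MeasurableSpace X] (ρ : X → X → ℝ)
    (μ : Measure X) (φ : ℕ → X → ℝ) (lam : ℕ → ℝ) (α : ℝ) : Prop where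
  quasiMetric : IsQuasiMetric ρ
  spectral : IsSpectralSystem μ φ lam
  alpha_pos : 0 < α
  isCompact_closedBall : ∀ (x : X) (t : ℝ), 0 < t → IsCompact {y | ρ x y ≤ t}
  measure_closedBall_le : ∃ C : ℝ, ∀ (x : X) (t : ℝ), 0 < t → μ.real {y | ρ x y ≤ t} ≤ C * t ^ α
  heatKernel_upper : ∃ c > (0 : ℝ), ∃ C : ℝ, ∀ (x y : X) (t : ℝ), 0 < t → t ≤ 1 →
    |heatKernel φ lam t x y| ≤ C * (t ^ (-(α / 2)) * Real.exp (-(c * (ρ x y ^ 2 / t))))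
  heatKernel_lower : ∃ C > (0 : ℝ), ∀ (x : X) (t : ℝ), 0 < t → t < 1 →
    C * t ^ (-(α / 2)) ≤ heatKernel φ lam t x x

/-- The admissible degrees `N = 2ⁿ`, `n = 0, 1, 2, …`. -/
def dyadic : Set ℕ := Set.range fun n : ℕ => 2 ^ n

/-- The space `Π_L` of diffusion polynomials of degree at most `L`. -/
def diffPoly (φ : ℕ → X → ℝ) (lam : ℕ → ℝ) (L : ℝ) : Submodule ℝ (X → ℝ) :=
  Submodule.span ℝ (φ '' {k | lam k ≤ L})

/-- The strong product assumption with constant `a`. -/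
def StrongProduct (φ : ℕ → X → ℝ) (lam : ℕ → ℝ) (a : ℝ) : Prop :=
  ∀ N ∈ dyadic, ∀ f ∈ diffPoly φ lam N, ∀ g ∈ diffPoly φ lam N, f * g ∈ diffPoly φ lam (a * N)

/-- `E(f, Π_L, L_p(μ))`, the error of best approximation of `f` from `Π_L`. -/
def bestError [MeasurableSpace X] (μ : Measure X) (φ : ℕ → X → ℝ) (lam : ℕ → ℝ) (p : ℝ≥0∞)
    (f : X → ℝ) (L : ℝ) : ℝ≥0∞ :=
  ⨅ g ∈ diffPoly φ lam L, eLpNorm (f - g) p μ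

/-- The Sobolev norm `‖f‖_{L_p} + sup_N N^s E(f, Π_N, L_p)`. -/
def sobolevNorm [MeasurableSpace X] (μ : Measure X) (φ : ℕ → X → ℝ) (lam : ℕ → ℝ) (s : ℝ)
    (p : ℝ≥0∞) (f : X → ℝ) : ℝ≥0∞ :=
  eLpNorm f p μ + ⨆ N ∈ dyadic, ENNReal.ofReal ((N : ℝ) ^ s) * bestError μ φ lam p f N

/-- The ball of radius `r` of the Sobolev space `W^s(L_p)`. For `p = ∞` every element of the Sobolev
space is the class of exactly one continuous function, and it is this representative that is
evaluated at points; so the representatives are taken continuous for `p = ∞`. -/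
def sobolevBall [TopologicalSpace X] [MeasurableSpace X] (μ : Measure X) (φ : ℕ → X → ℝ)
    (lam : ℕ → ℝ) (s : ℝ) (p : ℝ≥0∞) (r : ℝ) : Set (X → ℝ) :=
  {f | MemLp f p μ ∧ (p = ∞ → Continuous f) ∧ sobolevNorm μ φ lam s p f ≤ ENNReal.ofReal r}

/-- `ν` is a quadrature measure of order `N`: it integrates `Π_{aN}` exactly. -/
def IsQuadrature [MeasurableSpace X] (μ : Measure X) (φ : ℕ → X → ℝ) (lam : ℕ → ℝ) (a N : ℝ)
    (ν : SignedMeasure X) : Prop :=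
  ∀ f ∈ diffPoly φ lam (a * N), ∫ x, f x ∂μ = ∫ᵛ x, f x ∂<•ν

/-- `(ν_N)` is a uniform family of Marcinkiewicz-Zygmund measures of order `N` for the exponent
`q`: the norms of `L_q(|ν_N|)` and `L_q(μ)` are equivalent on `Π_{aN}`, uniformly in `N`. -/
def IsUniformMZ [MeasurableSpace X] (μ : Measure X) (φ : ℕ → X → ℝ) (lam : ℕ → ℝ) (a : ℝ)
    (q : ℝ≥0∞) (ν : ℕ → SignedMeasure X) : Prop :=
  ∃ A > (0 : ℝ), ∃ B : ℝ, ∀ N ∈ dyadic, ∀ f ∈ diffPoly φ lam (a * N),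
    ENNReal.ofReal A * eLpNorm f q μ ≤ eLpNorm f q (ν N).variation ∧
      eLpNorm f q (ν N).variation ≤ ENNReal.ofReal B * eLpNorm f q μ

/-- Low-pass filters; only the values on `[0, ∞)` matter. -/
structure IsLowPass (H : ℝ → ℝ) : Prop where
  smooth : ContDiffOn ℝ (⊤ : ℕ∞) H (Set.Ici 0)
  anti : AntitoneOn H (Set.Ici 0)
  eq_one : ∀ t, 0 ≤ t → t ≤ 1 / 2 → H t = 1
  eq_zero : ∀ t, 1 ≤ t → H t = 0

/-- `σ_N(f, ν) = ∑ₖ H(λₖ / N) (∫ f φₖ dν) φₖ`; only finitely many terms are nonzero. -/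
def sigma [MeasurableSpace X] (φ : ℕ → X → ℝ) (lam : ℕ → ℝ) (H : ℝ → ℝ) (N : ℝ) (f : X → ℝ)
    (ν : SignedMeasure X) (x : X) : ℝ :=
  ∑' k, H (lam k / N) * (∫ᵛ y, f y * φ k y ∂<•ν) * φ k x

/-- The quantized values `I_N(f, ν, y) = ⌊N^S σ_N(f, ν, y)⌋`. -/
def quantized [MeasurableSpace X] (φ : ℕ → X → ℝ) (lam : ℕ → ℝ) (H : ℝ → ℝ) (S N : ℝ) (f : X → ℝ)
    (ν : SignedMeasure X) (y : X) : ℤ :=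
  ⌊N ^ S * sigma φ lam H N f ν y⌋

/-- The reconstruction
`σ°_N(f, μ_N, ν_N) = N^{-S} ∑ₖ H(λₖ / (2N)) (∫ I_N(f, μ_N, y) φₖ(y) dν_N(y)) φₖ`. -/
def sigmaQuantized [MeasurableSpace X] (φ : ℕ → X → ℝ) (lam : ℕ → ℝ) (H : ℝ → ℝ) (S N : ℝ)
    (f : X → ℝ) (μN νN : SignedMeasure X) (x : X) : ℝ :=
  N ^ (-S) * ∑' k, H (lam k / (2 * N)) *
    (∫ᵛ y, (quantized φ lam H S N f μN y : ℝ) * φ k y ∂<•νN) * φ k x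

/-- The length of the signed binary expansion of an integer: a sign bit and the binary digits of
its absolute value. -/
def intBits (m : ℤ) : ℕ := 1 + Nat.size m.natAbs

/-- The number of bits needed to store the integers `I y`, `y ∈ T`, for an arbitrary member `I` of a
family `J`, when all of them are written in signed binary with one common word length. -/
def bitCost (T : Set X) (J : Set (X → ℤ)) : ℕ∞ :=
  T.encard * ⨆ I ∈ J, ⨆ y ∈ T, (intBits (I y) : ℕ∞)

end DiffusionQuantization

end

open DiffusionQuantization

/-! Everything rests on localization of the kernels `Φ_L(x,y) = ∑ H(λₖ/L) φₖ(x) φₖ(y)`, namely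
`|Φ_L| ≲ L^α / (1 + L ρ)^m + 1` (`exists_abs_lowPassKernel_le`). It is extracted from the Gaussian
bounds alone. Write `H(v) = ψ(exp(-v²)) exp(-v²)` with `ψ` smooth. The moments of the weights
`exp(-λₖ²/L²) φₖ(x) φₖ(y)` in `exp(-λₖ²/L²)` are heat kernels at times `(i+1)/L²`, exponentially
small while `i` is at most a small multiple of `L ρ`, and a Chebyshev expansion bounds the sum
against `ψ` by these moments plus a polynomially small tail.

The ball condition then bounds `∫ |Φ_L(x,·)| dμ` uniformly. The same holds for `|ν_N|`, although the
MZ inequality is only an `L_q` statement about polynomials: the lower heat kernel bound forces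
`|Φ_L(·,y)|^q` to have mass near `y`, so the weight is dominated by its own average against
`|Φ_L|^q`. Fubini and the MZ inequality for `Φ_L(z,·)` conclude (`exists_kernelWeight_mul_le`,
`exists_lintegral_kernelWeight_le`).

Hence `σ_N` is bounded on `L_p`. By the product assumption and quadrature it reproduces `Π_{N/2}`,
so its error is at most a multiple of that of best approximation, which is `≲ r N^{-s}`. Rounding
perturbs `σ_N f` by at most `N^{-S}`, and `σ_{2N}`, which reproduces `σ_N f`, keeps this order;
since `S > s` and `r ≥ r₀`, it is absorbed.

For the bits, `r/ε = N^s/c`, so the number of nodes is `≲ N^α = (c r/ε)^{α/s}`. From `ε ≤ 1` one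
gets `r ≤ N^s/c`, so all integers are bounded by a power of `N` and the word length is `≲ 1 +
log₂(r/ε)`. -/

/-! ### Chebyshev expansions and sums controlled by moments. -/

open Polynomial.Chebyshev in
-- Each integration by parts gains a factor `1 / |k|`, the boundary terms cancelling by periodicity.
-- The function is quantified after `m` so that the induction can pass to its derivative.
theorem exists_norm_fourierCoeffOn_le (T : ℝ) (hT : (0 : ℝ) < 0 + T) (m : ℕ) : ∀ f : ℝ → ℂ, ContDiff ℝ (⊤ : ℕ∞) f →
    Function.Periodic f T → ∃ C : ℝ, ∀ k : ℤ, k ≠ 0 →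
      ‖fourierCoeffOn hT f k‖ ≤ C / |(k : ℝ)| ^ m := by
  induction m with
  | zero =>
    intro f hf hp
    obtain ⟨C, hC⟩ := (isCompact_Icc (a := (0:ℝ)) (b := 0 + T)).exists_bound_of_continuousOn
      hf.continuous.continuousOn
    refine ⟨|1 / (0 + T - 0)| * (C * |0 + T - 0|), fun k _ => ?_⟩
    rw [fourierCoeffOn_eq_integral, norm_smul, Real.norm_eq_abs, pow_zero, div_one]
    refine mul_le_mul_of_nonneg_left ?_ (abs_nonneg _)
    refine intervalIntegral.norm_integral_le_of_norm_le_const fun x hx => ?_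
    rw [Set.uIoc_of_le hT.le] at hx
    have : Fact (0 < 0 + T - 0) := ⟨by simpa using hT⟩
    rw [norm_smul, fourier_apply, Circle.norm_coe, one_mul]
    exact hC x ⟨hx.1.le, hx.2⟩
  | succ m ih =>
    intro f hf hp
    have hd : ContDiff ℝ (⊤ : ℕ∞) (deriv f) := by
      have := (contDiff_infty_iff_deriv (f := f)).1 hf
      exact this.2
    have hdiff : Differentiable ℝ f := hf.differentiable (by simp)
    have hpd : Function.Periodic (deriv f) T := fun x => by
      rw [← deriv_comp_add_const]
      congr 1
      exact funext hp
    obtain ⟨C, hC⟩ := ih _ hd hpd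
    have hT' : 0 < T := by simpa using hT
    refine ⟨T / (2 * Real.pi) * C, fun k hk => ?_⟩
    rw [fourierCoeffOn_of_hasDerivAt hT hk (fun x _ => (hdiff x).hasDerivAt)
      (hd.continuous.intervalIntegrable _ _), hp 0, sub_self, mul_zero, zero_sub]
    have hk' : 0 < |(k : ℝ)| := abs_pos.2 (by exact_mod_cast hk)
    have h1 := hC k hk
    rw [norm_mul, norm_neg, norm_mul]
    have e1 : ‖(1 / (-2 * (Real.pi : ℂ) * Complex.I * k) : ℂ)‖ = 1 / (2 * Real.pi * |(k : ℝ)|) := by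
      simp [abs_of_pos Real.pi_pos]
    have e2 : ‖(((0 + T : ℝ) : ℂ) - ((0 : ℝ) : ℂ))‖ = T := by
      simp [abs_of_pos hT']
    rw [e1, e2]
    calc _ ≤ 1 / (2 * Real.pi * |(k : ℝ)|) * (T * (C / |(k : ℝ)| ^ m)) := by gcongr
      _ = _ := by
        have := Real.pi_pos
        field_simp
        ring

open Polynomial.Chebyshev in
/-- Smooth functions have rapidly convergent Chebyshev expansions. -/
theorem exists_hasSum_chebyshev {ψ : ℝ → ℝ} (hψ : ContDiff ℝ (⊤ : ℕ∞) ψ) (m : ℕ) :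
    ∃ c : ℤ → ℝ, (Summable fun j : ℤ => |(j : ℝ)| ^ m * |c j|) ∧ Summable (fun j => |c j|) ∧
      ∀ u ∈ Set.Icc (0 : ℝ) 1,
        HasSum (fun j : ℤ => c j * (T ℝ j).eval (2 * u - 1)) (ψ u) := by
  set τ : ℝ := 2 * Real.pi with hτ
  have hτ0 : 0 < τ := by positivity
  have : Fact (0 < τ) := ⟨hτ0⟩
  have hT : (0 : ℝ) < 0 + τ := by simpa using hτ0
  -- The substitution `2u - 1 = cos θ` makes `ψ` a smooth even periodic function, so its Fourier
  -- series becomes a Chebyshev series in `u`.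
  set f : ℝ → ℂ := fun θ => ((ψ ((1 + Real.cos θ) / 2) : ℝ) : ℂ) with hf
  have hfs : ContDiff ℝ (⊤ : ℕ∞) f := by
    refine Complex.ofRealCLM.contDiff.comp (hψ.comp ?_)
    exact (contDiff_const.add Real.contDiff_cos).div_const 2
  have hper : Function.Periodic f τ := fun x => by simp [hf, hτ]
  have hcont : Continuous (AddCircle.liftIco τ 0 f) :=
    AddCircle.liftIco_zero_continuous (by simpa using (hper 0).symm) hfs.continuous.continuousOn
  set F : C(AddCircle τ, ℂ) := ⟨_, hcont⟩ with hF
  have hFco : ∀ θ : ℝ, F (θ : AddCircle τ) = f θ := by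
    intro θ
    obtain ⟨y, hy, hxy⟩ := hper.exists_mem_Ico₀ hτ0 θ
    obtain ⟨n, hn⟩ : ∃ n : ℤ, toIcoMod hτ0 0 θ = θ - n • τ := ⟨toIcoDiv hτ0 0 θ, rfl⟩
    have h1 : ((toIcoMod hτ0 0 θ : ℝ) : AddCircle τ) = θ := by
      rw [hn, AddCircle.coe_sub, AddCircle.coe_zsmul]
      simp [AddCircle.coe_period]
    have h2 : F ((toIcoMod hτ0 0 θ : ℝ) : AddCircle τ) = f (toIcoMod hτ0 0 θ) :=
      AddCircle.liftIco_zero_coe_apply (f := f) (by simpa using toIcoMod_mem_Ico hτ0 0 θ)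
    rw [← h1, h2, hn]
    exact hper.sub_zsmul_eq n
  have hcoef : ∀ k, fourierCoeff F k = fourierCoeffOn hT f k := fun k =>
    fourierCoeff_liftIco_eq f k
  have key : ∀ l : ℕ, Summable fun j : ℤ => |(j : ℝ)| ^ l * ‖fourierCoeff F j‖ := by
    intro l
    -- Two powers of decay beyond `l` leave the summable majorant `C / j²`; only `j = 0` escapes it.
    obtain ⟨C, hC⟩ := exists_norm_fourierCoeffOn_le τ hT (l + 2) f hfs hper
    have hs : Summable fun j : ℤ => C * (1 / (j : ℝ) ^ 2) :=
      (Real.summable_one_div_int_pow.2 (by norm_num : 1 < 2)).mul_left C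
    refine Summable.of_norm_bounded_eventually hs ?_
    filter_upwards [(Set.finite_singleton (0 : ℤ)).compl_mem_cofinite] with j hj
    have hj0 : (j : ℤ) ≠ 0 := hj
    have hj' : 0 < |(j : ℝ)| := abs_pos.2 (by exact_mod_cast hj0)
    rw [Real.norm_eq_abs, abs_of_nonneg (by positivity), hcoef]
    calc _ ≤ |(j : ℝ)| ^ l * (C / |(j : ℝ)| ^ (l + 2)) := by
          gcongr; exact hC j hj0
      _ = _ := by
        rw [← sq_abs (j : ℝ)]
        field_simp
        ring
  have hs0 : Summable fun j : ℤ => ‖fourierCoeff F j‖ := by simpa using key 0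
  refine ⟨fun j => (fourierCoeff F j).re, ?_, ?_, ?_⟩
  · exact (key m).of_nonneg_of_le (fun j => by positivity)
      fun j => by gcongr; exact Complex.abs_re_le_norm _
  · exact hs0.of_nonneg_of_le (fun j => by positivity) fun j => Complex.abs_re_le_norm _
  · intro u hu
    set θ := Real.arccos (2 * u - 1) with hθ
    have hcos : Real.cos θ = 2 * u - 1 := Real.cos_arccos (by linarith [hu.1]) (by linarith [hu.2])
    have hfθ : f θ = (ψ u : ℂ) := by simp [hf, hcos]
    have hfθ' : f (-θ) = (ψ u : ℂ) := by simp [hf, hcos]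
    have hs := has_pointwise_sum_fourier_series_of_summable hs0.of_norm
    -- Averaging the series at `θ` and `-θ` replaces the exponentials by `cos (jθ) = T_j (cos θ)`.
    have h1 := hs (θ : AddCircle τ)
    have h2 := hs ((-θ : ℝ) : AddCircle τ)
    rw [hFco, hfθ] at h1
    rw [hFco, hfθ'] at h2
    have h3 := Complex.hasSum_re ((h1.add h2).div_const 2)
    convert h3 using 1
    · funext j
      rw [← hcos, T_real_cos, fourier_coe_apply, fourier_coe_apply, smul_eq_mul, smul_eq_mul,
        ← mul_add, mul_div_assoc]
      have : (Complex.exp (2 * Real.pi * Complex.I * j * θ / τ) +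
          Complex.exp (2 * Real.pi * Complex.I * j * ((-θ : ℝ) : ℂ) / τ)) / 2 =
            ((Real.cos (j * θ) : ℝ) : ℂ) := by
        rw [Complex.ofReal_cos, Complex.cos]
        have hpi : (Real.pi : ℂ) ≠ 0 := by exact_mod_cast Real.pi_ne_zero
        congr 3
        · push_cast [hτ]; field_simp
        · push_cast [hτ]; field_simp
      rw [this, Complex.re_mul_ofReal]
    · norm_num

open Polynomial.Chebyshev in
-- The recurrence in the variable `2u - 1` reads `T_{j+2} = 4u T_{j+1} - 2 T_{j+1} - T_j`, and `4 +
-- 2 + 1 = 7`. The free power `u ^ i` is there because the factor `u` costs one further moment at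
-- each step.
theorem abs_tsum_pow_mul_chebyshev_le {u b : ℕ → ℝ} (hu : ∀ k, u k ∈ Set.Icc (0 : ℝ) 1)
    (hb : Summable fun k => |b k|) {M : ℝ} {n : ℕ} (hM : ∀ i ≤ n, |∑' k, u k ^ i * b k| ≤ M)
    (j : ℕ) : ∀ i, i + j ≤ n →
      |∑' k, u k ^ i * (T ℝ j).eval (2 * u k - 1) * b k| ≤ 7 ^ j * M := by
  have hsum : ∀ (i : ℕ) (j : ℤ), Summable fun k => u k ^ i * (T ℝ j).eval (2 * u k - 1) * b k := by
    intro i j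
    refine Summable.of_norm_bounded hb fun k => ?_
    rw [Real.norm_eq_abs, abs_mul, abs_mul]
    have h1 : |u k ^ i| ≤ 1 := by
      rw [abs_of_nonneg (pow_nonneg (hu k).1 i)]; exact pow_le_one₀ (hu k).1 (hu k).2
    have h2 : |(T ℝ j).eval (2 * u k - 1)| ≤ 1 :=
      abs_eval_T_real_le_one j (abs_le.2 ⟨by linarith [(hu k).1], by linarith [(hu k).2]⟩)
    calc _ ≤ 1 * 1 * |b k| := by gcongr
      _ = _ := by ring
  induction j using Nat.strong_induction_on with
  | _ j ih =>
    intro i hij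
    have hM0 : 0 ≤ M := (abs_nonneg _).trans (hM 0 (Nat.zero_le _))
    match j, ih, hij with
    | 0, _, hij => simpa using hM i (by omega)
    | 1, _, hij =>
      have e : (fun k => u k ^ i * (T ℝ ((1 : ℕ) : ℤ)).eval (2 * u k - 1) * b k) =
          fun k => 2 * (u k ^ (i + 1) * b k) - u k ^ i * b k := by
        funext k; simp; ring
      have s1 : ∀ i, Summable fun k => u k ^ i * b k := fun i => by simpa using hsum i 0
      rw [e, ((s1 (i + 1)).mul_left 2).tsum_sub (s1 i), tsum_mul_left]
      have h1 := abs_le.1 (hM i (by omega))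
      have h2 := abs_le.1 (hM (i + 1) (by omega))
      rw [abs_le]; constructor <;> linarith
    | j + 2, ih, hij =>
      have e : (fun k => u k ^ i * (T ℝ ((j + 2 : ℕ) : ℤ)).eval (2 * u k - 1) * b k) =
          fun k => 4 * (u k ^ (i + 1) * (T ℝ ((j + 1 : ℕ) : ℤ)).eval (2 * u k - 1) * b k)
            - 2 * (u k ^ i * (T ℝ ((j + 1 : ℕ) : ℤ)).eval (2 * u k - 1) * b k)
            - u k ^ i * (T ℝ (j : ℤ)).eval (2 * u k - 1) * b k := by
        funext k
        push_cast
        rw [T_add_two]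
        simp
        ring
      rw [e, (((hsum (i + 1) _).mul_left 4).sub ((hsum i _).mul_left 2)).tsum_sub (hsum i _),
        ((hsum (i + 1) _).mul_left 4).tsum_sub ((hsum i _).mul_left 2), tsum_mul_left,
        tsum_mul_left]
      have h1 := abs_le.1 (ih (j + 1) (by omega) (i + 1) (by omega))
      have h2 := abs_le.1 (ih (j + 1) (by omega) i (by omega))
      have h3 := abs_le.1 (ih j (by omega) i (by omega))
      have hp : 0 ≤ 7 ^ j * M := by positivity
      rw [pow_succ] at h1 h2
      rw [abs_le, pow_succ, pow_succ]; constructor <;> nlinarith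

open Polynomial.Chebyshev in
/-- Bound of `∑ ψ(uₖ) bₖ` by the first `n` moments of `b`. -/
theorem exists_abs_tsum_comp_mul_le {ψ : ℝ → ℝ} (hψ : ContDiff ℝ (⊤ : ℕ∞) ψ) (m : ℕ) :
    ∃ C > 0, ∀ (u b : ℕ → ℝ), (∀ k, u k ∈ Set.Icc (0 : ℝ) 1) → (Summable fun k => |b k|) →
      ∀ (M : ℝ) (n : ℕ), 1 ≤ n → (∀ i ≤ n, |∑' k, u k ^ i * b k| ≤ M) →
        |∑' k, ψ (u k) * b k| ≤ C * (7 ^ n * (2 * n + 1) * M + (∑' k, |b k|) / n ^ m) := by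
  obtain ⟨c, hcm, hc, hs⟩ := exists_hasSum_chebyshev hψ m
  set W := ∑' j : ℤ, |(j : ℝ)| ^ m * |c j| with hW
  set V := ∑' j : ℤ, |c j| with hV
  have hW0 : 0 ≤ W := tsum_nonneg fun j => by positivity
  have hV0 : 0 ≤ V := tsum_nonneg fun j => by positivity
  refine ⟨W + V + 1, by positivity, fun u b hu hb M n hn hM => ?_⟩
  have hM0 : 0 ≤ M := (abs_nonneg _).trans (hM 0 (Nat.zero_le _))
  have hn0 : (0 : ℝ) < n := by exact_mod_cast hn
  have hb0 : 0 ≤ ∑' k, |b k| := tsum_nonneg fun k => abs_nonneg _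
  have hT : ∀ (j : ℤ) k, |(T ℝ j).eval (2 * u k - 1)| ≤ 1 := fun j k =>
    abs_eval_T_real_le_one j (abs_le.2 ⟨by linarith [(hu k).1], by linarith [(hu k).2]⟩)
  set s : Finset ℤ := Finset.Icc (-(n : ℤ)) n with hsdef
  -- Truncation at degree `n`: the polynomial part is controlled by the moments, the tail by `W / n
  -- ^ m`.
  set P : ℕ → ℝ := fun k => ∑ j ∈ s, c j * (T ℝ j).eval (2 * u k - 1) with hP
  have herr : ∀ k, |ψ (u k) - P k| ≤ W / n ^ m := by
    intro k
    have h1 := hs (u k) (hu k)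
    have h2 : ψ (u k) - P k = ∑' j : ↥((s : Set ℤ)ᶜ), c j * (T ℝ (j : ℤ)).eval (2 * u k - 1) := by
      rw [← h1.tsum_eq, ← h1.summable.sum_add_tsum_compl (s := s)]
      simp [hP]
    have h3 : ∀ j : ↥((s : Set ℤ)ᶜ), ‖c j * (T ℝ (j : ℤ)).eval (2 * u k - 1)‖ ≤
        (|((j : ℤ) : ℝ)| ^ m * |c j|) / n ^ m := by
      rintro ⟨j, hj⟩
      have hj' : (n : ℝ) ≤ |(j : ℝ)| := by
        have : ¬ (-(n : ℤ) ≤ j ∧ j ≤ n) := by simpa [hsdef] using hj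
        have : (n : ℤ) ≤ |j| := by
          rw [le_abs]; omega
        exact_mod_cast this
      rw [Real.norm_eq_abs, abs_mul]
      calc _ ≤ |c j| * 1 := by gcongr; exact hT j k
        _ ≤ |c j| * (|(j : ℝ)| ^ m / n ^ m) := by
          gcongr
          rw [one_le_div (by positivity)]
          gcongr
        _ = _ := by ring
    rw [h2, ← Real.norm_eq_abs]
    have hsum : Summable fun j : ↥((s : Set ℤ)ᶜ) => (|((j : ℤ) : ℝ)| ^ m * |c j|) / n ^ m :=
      (hcm.subtype _).div_const _
    refine (tsum_of_norm_bounded hsum.hasSum h3).trans ?_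
    rw [tsum_div_const]
    gcongr
    exact hcm.tsum_subtype_le _ _ (fun j => by positivity)
  have hTsum : ∀ j : ℤ, Summable fun k => (T ℝ j).eval (2 * u k - 1) * b k := fun j => by
    refine Summable.of_norm_bounded hb fun k => ?_
    rw [Real.norm_eq_abs, abs_mul]
    exact mul_le_of_le_one_left (abs_nonneg _) (hT j k)
  have hPeq : (fun k => P k * b k) =
      fun k => ∑ j ∈ s, c j * ((T ℝ j).eval (2 * u k - 1) * b k) := by
    funext k; simp only [hP, Finset.sum_mul, mul_assoc]
  have hPs : Summable fun k => P k * b k := by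
    rw [hPeq]
    exact summable_sum fun j _ => (hTsum j).mul_left _
  have hPb : |∑' k, P k * b k| ≤ V * (7 ^ n * (2 * n + 1) * M) := by
    rw [hPeq, Summable.tsum_finsetSum fun j _ => (hTsum j).mul_left _]
    have hterm : ∀ j ∈ s, |∑' k, c j * ((T ℝ j).eval (2 * u k - 1) * b k)| ≤
        |c j| * (7 ^ n * M) := by
      intro j hj
      rw [tsum_mul_left, abs_mul]
      have hjn : j.natAbs ≤ n := by
        simp only [hsdef, Finset.mem_Icc] at hj; omega
      have h := abs_tsum_pow_mul_chebyshev_le hu hb hM j.natAbs 0 (by omega)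
      simp only [pow_zero, one_mul, T_natAbs] at h
      gcongr
      refine h.trans ?_
      gcongr
      norm_num
    refine (Finset.abs_sum_le_sum_abs _ _).trans ((Finset.sum_le_sum hterm).trans ?_)
    rw [← Finset.sum_mul]
    have h1 : ∑ j ∈ s, |c j| ≤ V := hc.sum_le_tsum s fun j _ => abs_nonneg _
    calc _ ≤ V * (7 ^ n * M) := by gcongr
      _ ≤ V * (7 ^ n * (2 * n + 1) * M) := by
        gcongr
        have : (0 : ℝ) ≤ 7 ^ n * (2 * n) := by positivity
        linarith
  have hEs : Summable fun k => (ψ (u k) - P k) * b k := by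
    refine Summable.of_norm_bounded (hb.mul_left (W / n ^ m)) fun k => ?_
    rw [Real.norm_eq_abs, abs_mul]
    gcongr
    exact herr k
  have hEb : |∑' k, (ψ (u k) - P k) * b k| ≤ W * ((∑' k, |b k|) / n ^ m) := by
    have := tsum_of_norm_bounded (f := fun k => (ψ (u k) - P k) * b k)
      (hb.mul_left (W / n ^ m)).hasSum fun k => by
        rw [Real.norm_eq_abs, abs_mul]
        gcongr
        exact herr k
    rw [tsum_mul_left] at this
    calc _ ≤ _ := this
      _ = _ := by ring
  have htot : ∑' k, ψ (u k) * b k = ∑' k, (ψ (u k) - P k) * b k + ∑' k, P k * b k := by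
    rw [← hEs.tsum_add hPs]
    congr 1; funext k; ring
  rw [htot]
  refine (abs_add_le _ _).trans ((add_le_add hEb hPb).trans ?_)
  have q1 : 0 ≤ 7 ^ n * (2 * (n : ℝ) + 1) * M := by positivity
  have q2 : 0 ≤ (∑' k, |b k|) / (n : ℝ) ^ m := by positivity
  nlinarith [mul_nonneg hW0 q1, mul_nonneg hV0 q2]

/-! ### Localization of the low pass kernels. -/

namespace DiffusionQuantization

variable {X : Type*} [TopologicalSpace X] [MeasurableSpace X]
  {ρ : X → X → ℝ} {μ : Measure X} {φ : ℕ → X → ℝ} {lam : ℕ → ℝ} {α : ℝ} {H : ℝ → ℝ}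

/-- The localized kernel `∑ₖ H(λₖ / L) φₖ(x) φₖ(y)`. -/
noncomputable def lowPassKernel (φ : ℕ → X → ℝ) (lam : ℕ → ℝ) (H : ℝ → ℝ) (L : ℝ) (x y : X) : ℝ :=
  ∑' k, H (lam k / L) * φ k x * φ k y

/-- The majorant of the localized kernel. -/
noncomputable def kernelWeight (ρ : X → X → ℝ) (α : ℝ) (m : ℕ) (L : ℝ) (x y : X) : ℝ :=
  L ^ α / (1 + L * ρ x y) ^ m + 1

theorem IsLowPass.nonneg (hH : IsLowPass H) {t : ℝ} (ht : 0 ≤ t) : 0 ≤ H t := by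
  have h := hH.anti ht (show (0 : ℝ) ≤ max t 1 from le_max_of_le_left ht) (le_max_left t 1)
  rwa [hH.eq_zero _ (le_max_right _ _)] at h

theorem IsLowPass.le_one (hH : IsLowPass H) {t : ℝ} (ht : 0 ≤ t) : H t ≤ 1 := by
  have h := hH.anti (le_refl (0 : ℝ)) ht ht
  rwa [hH.eq_one 0 le_rfl (by norm_num)] at h

/-- A low pass filter is a smooth function of the Gaussian, divisible by the Gaussian. -/
theorem IsLowPass.exists_contDiff (hH : IsLowPass H) :
    ∃ ψ : ℝ → ℝ, ContDiff ℝ (⊤ : ℕ∞) ψ ∧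
      ∀ v, 0 ≤ v → ψ (Real.exp (-v ^ 2)) * Real.exp (-v ^ 2) = H v := by
  classical
  -- For `u ≤ exp (-1)` one has `√(-log u) ≥ 1`, where `H` vanishes, so `ψ` is smooth through `0`.
  -- Near `u ≥ 1` the square root is not smooth, but `H = 1` there (beyond `1` because `√` of a
  -- negative number is `0`), so `ψ u = 1 / u`.
  set ψ : ℝ → ℝ := fun u => if u ≤ Real.exp (-1) then 0 else H (√(-Real.log u)) / u with hψ
  have hpos : ∀ u, 0 < u → ψ u = H (√(-Real.log u)) / u := by
    intro u hu
    simp only [hψ]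
    split_ifs with h
    · rw [hH.eq_zero, zero_div]
      rw [Real.le_sqrt' one_pos]
      have := (Real.log_le_iff_le_exp hu).2 h
      linarith
    · rfl
  refine ⟨ψ, ?_, ?_⟩
  · rw [contDiff_iff_contDiffAt]
    intro u
    rcases lt_or_ge u (Real.exp (-1)) with h1 | h1
    · have : ψ =ᶠ[𝓝 u] fun _ => 0 := by
        filter_upwards [Iio_mem_nhds h1] with v hv
        simp only [hψ]
        rw [if_pos (le_of_lt hv)]
      exact contDiffAt_const.congr_of_eventuallyEq this
    have hu0 : 0 < u := (Real.exp_pos _).trans_le h1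
    rcases lt_or_ge u 1 with h2 | h2
    · have he : ψ =ᶠ[𝓝 u] fun u => H (√(-Real.log u)) / u := by
        filter_upwards [Ioi_mem_nhds hu0] with v hv using hpos v hv
      refine ContDiffAt.congr_of_eventuallyEq ?_ he
      have hlog : 0 < -Real.log u := by
        have := Real.log_neg hu0 h2
        linarith
      refine ContDiffAt.div ?_ contDiffAt_id hu0.ne'
      have hs : ContDiffAt ℝ (⊤ : ℕ∞) H (√(-Real.log u)) :=
        hH.smooth.contDiffAt (Ici_mem_nhds (Real.sqrt_pos.2 hlog))
      exact hs.comp u (ContDiffAt.sqrt (Real.contDiffAt_log.2 hu0.ne').neg hlog.ne')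
    · have h3 : Real.exp (-1 / 4) < u := (Real.exp_lt_one_iff.2 (by norm_num)).trans_le h2
      have he : ψ =ᶠ[𝓝 u] fun u => 1 / u := by
        filter_upwards [Ioi_mem_nhds h3] with v hv
        have hv0 : 0 < v := (Real.exp_pos _).trans hv
        rw [hpos v hv0, hH.eq_one _ (Real.sqrt_nonneg _)]
        rw [Real.sqrt_le_left (by norm_num)]
        have := (Real.lt_log_iff_exp_lt hv0).2 hv
        norm_num at this ⊢
        linarith
      exact (contDiffAt_const.div contDiffAt_id hu0.ne').congr_of_eventuallyEq he
  · intro v hv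
    rw [hpos _ (Real.exp_pos _), Real.log_exp, neg_neg, Real.sqrt_sq hv,
      div_mul_cancel₀ _ (Real.exp_pos _).ne']

theorem IsSpectralSystem.lam_nonneg (h : IsSpectralSystem μ φ lam) (k : ℕ) : 0 ≤ lam k := by
  rw [← h.lam_zero]; exact h.lam_mono (Nat.zero_le k)

theorem IsSpectralSystem.finite_le (h : IsSpectralSystem μ φ lam) (L : ℝ) :
    {k | lam k ≤ L}.Finite := by
  have := h.lam_tendsto.eventually_gt_atTop L
  rw [← Nat.cofinite_eq_atTop, Filter.eventually_cofinite] at this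
  simpa using this

/-- The indices of the frequencies up to `L`. -/
noncomputable def IsSpectralSystem.lowFreq (h : IsSpectralSystem μ φ lam) (L : ℝ) : Finset ℕ :=
  (h.finite_le L).toFinset

theorem IsSpectralSystem.mem_lowFreq (h : IsSpectralSystem μ φ lam) {L : ℝ} {k : ℕ} :
    k ∈ h.lowFreq L ↔ lam k ≤ L := by simp [IsSpectralSystem.lowFreq]

theorem IsSpectralSystem.filter_eq_zero (h : IsSpectralSystem μ φ lam) (hH : IsLowPass H) {L : ℝ}
    (hL : 0 < L) {k : ℕ} (hk : k ∉ h.lowFreq L) : H (lam k / L) = 0 := by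
  rw [h.mem_lowFreq, not_le] at hk
  exact hH.eq_zero _ ((one_le_div hL).2 hk.le)

theorem IsSpectralSystem.tsum_filter (h : IsSpectralSystem μ φ lam) (hH : IsLowPass H) {L : ℝ}
    (hL : 0 < L) (F G : ℕ → ℝ) :
    ∑' k, H (lam k / L) * F k * G k = ∑ k ∈ h.lowFreq L, H (lam k / L) * F k * G k :=
  tsum_eq_sum fun k hk => by rw [h.filter_eq_zero hH hL hk, zero_mul, zero_mul]

theorem IsSpectralSystem.lowPassKernel_eq_sum (h : IsSpectralSystem μ φ lam) (hH : IsLowPass H)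
    {L : ℝ} (hL : 0 < L) (x y : X) :
    lowPassKernel φ lam H L x y = ∑ k ∈ h.lowFreq L, H (lam k / L) * φ k x * φ k y :=
  h.tsum_filter hH hL _ _

omit [TopologicalSpace X] [MeasurableSpace X] in
theorem lowPassKernel_comm (L : ℝ) (x y : X) :
    lowPassKernel φ lam H L x y = lowPassKernel φ lam H L y x := by
  unfold lowPassKernel
  congr 1; funext k; ring

/-- A divergent series would have `tsum` zero, against the lower heat kernel bound. That bound is
available only for `t < 1`; larger times are compared with `min t (1 / 2)`. -/
theorem IsDiffusionMeasureSpace.summable_diag (hX : IsDiffusionMeasureSpace ρ μ φ lam α) (x : X)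
    {t : ℝ} (ht : 0 < t) : Summable fun k => Real.exp (-(lam k) ^ 2 * t) * φ k x ^ 2 := by
  obtain ⟨c, hc, hlow⟩ := hX.heatKernel_lower
  have key : ∀ t : ℝ, 0 < t → t < 1 → Summable fun k => Real.exp (-(lam k) ^ 2 * t) * φ k x ^ 2 := by
    intro t ht ht1
    have h1 : 0 < heatKernel φ lam t x x := lt_of_lt_of_le (by positivity) (hlow x t ht ht1)
    by_contra hns
    apply h1.ne'
    apply tsum_eq_zero_of_not_summable
    simpa [mul_assoc, sq] using hns
  set t' := min t (1 / 2) with ht'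
  refine (key t' (by positivity) ((min_le_right _ _).trans_lt (by norm_num))).of_nonneg_of_le
    (fun k => by positivity) fun k => ?_
  refine mul_le_mul_of_nonneg_right (Real.exp_le_exp.2 ?_) (sq_nonneg _)
  have := mul_le_mul_of_nonneg_left (min_le_left t (1 / 2)) (sq_nonneg (lam k))
  rw [neg_mul, neg_mul]
  exact neg_le_neg this

theorem IsDiffusionMeasureSpace.exists_tsum_diag_le (hX : IsDiffusionMeasureSpace ρ μ φ lam α) :
    ∃ C > 0, ∀ (x : X) (t : ℝ), 0 < t → t ≤ 1 →
      ∑' k, Real.exp (-(lam k) ^ 2 * t) * φ k x ^ 2 ≤ C * t ^ (-(α / 2)) := by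
  obtain ⟨c, hc, C, hup⟩ := hX.heatKernel_upper
  refine ⟨|C| + 1, by positivity, fun x t ht ht1 => ?_⟩
  have h := hup x x t ht ht1
  have hρ : ρ x x = 0 := (hX.quasiMetric.eq_zero_iff x x).2 rfl
  have e : heatKernel φ lam t x x = ∑' k, Real.exp (-(lam k) ^ 2 * t) * φ k x ^ 2 := by
    unfold heatKernel; congr 1; funext k; ring
  rw [← e]
  rw [hρ] at h
  simp only [ne_eq, OfNat.ofNat_ne_zero, not_false_eq_true, zero_pow, zero_div, mul_zero, neg_zero,
    Real.exp_zero, mul_one] at h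
  refine (le_abs_self _).trans (h.trans ?_)
  gcongr
  linarith [le_abs_self C]

theorem IsDiffusionMeasureSpace.summable_abs (hX : IsDiffusionMeasureSpace ρ μ φ lam α) (x y : X)
    {t : ℝ} (ht : 0 < t) : Summable fun k => |Real.exp (-(lam k) ^ 2 * t) * φ k x * φ k y| := by
  refine ((hX.summable_diag x ht).add (hX.summable_diag y ht)).of_nonneg_of_le
    (fun k => abs_nonneg _) fun k => ?_
  rw [mul_assoc, abs_mul, abs_of_pos (Real.exp_pos _), ← mul_add, abs_mul]
  gcongr
  nlinarith [sq_nonneg (|φ k x| - |φ k y|), sq_abs (φ k x), sq_abs (φ k y), sq_nonneg (φ k x),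
    sq_nonneg (φ k y)]

theorem IsDiffusionMeasureSpace.exists_tsum_abs_le (hX : IsDiffusionMeasureSpace ρ μ φ lam α) :
    ∃ C > 0, ∀ (x y : X) (t : ℝ), 0 < t → t ≤ 1 →
      ∑' k, |Real.exp (-(lam k) ^ 2 * t) * φ k x * φ k y| ≤ C * t ^ (-(α / 2)) := by
  obtain ⟨C, hC, h⟩ := hX.exists_tsum_diag_le
  refine ⟨2 * C, by positivity, fun x y t ht ht1 => ?_⟩
  have hx := hX.summable_diag x ht
  have hy := hX.summable_diag y ht
  calc _ ≤ ∑' k, (Real.exp (-(lam k) ^ 2 * t) * φ k x ^ 2 + Real.exp (-(lam k) ^ 2 * t) * φ k y ^ 2) := by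
        refine (hX.summable_abs x y ht).tsum_le_tsum (fun k => ?_) (hx.add hy)
        rw [mul_assoc, abs_mul, abs_of_pos (Real.exp_pos _), ← mul_add, abs_mul]
        gcongr
        nlinarith [sq_nonneg (|φ k x| - |φ k y|), sq_abs (φ k x), sq_abs (φ k y), sq_nonneg (φ k x),
          sq_nonneg (φ k y)]
    _ = _ := hx.tsum_add hy
    _ ≤ _ := by linarith [h x t ht ht1, h y t ht ht1]

/-- The eigenfunctions are bounded. -/
theorem IsDiffusionMeasureSpace.exists_abs_phi_le (hX : IsDiffusionMeasureSpace ρ μ φ lam α)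
    (k : ℕ) : ∃ C : ℝ, ∀ x, |φ k x| ≤ C := by
  obtain ⟨C, hC, h⟩ := hX.exists_tsum_diag_le
  refine ⟨√(C / Real.exp (-(lam k) ^ 2)), fun x => Real.abs_le_sqrt ?_⟩
  rw [le_div_iff₀ (Real.exp_pos _)]
  have h1 := (hX.summable_diag x one_pos).le_tsum k fun j _ => by positivity
  have h2 := h x 1 one_pos le_rfl
  simp only [mul_one, Real.one_rpow] at h1 h2
  linarith

/-- The Christoffel function grows at least like `L ^ α`. -/
theorem IsDiffusionMeasureSpace.exists_le_sum_sq (hX : IsDiffusionMeasureSpace ρ μ φ lam α)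
    (hH : IsLowPass H) : ∃ c > 0, ∃ L₁ ≥ 1, ∀ L ≥ L₁, ∀ x,
      c * L ^ α ≤ ∑ k ∈ hX.spectral.lowFreq L, H (lam k / L) ^ 2 * φ k x ^ 2 := by
  obtain ⟨C, hC, hup⟩ := hX.exists_tsum_diag_le
  obtain ⟨c, hc, hlow⟩ := hX.heatKernel_lower
  have hα := hX.alpha_pos
  -- The heat kernel is taken at time `t = D / L²`. Frequencies above `L / 2` satisfy `exp(-λ²t) ≤
  -- exp(-D/8) exp(-λ²t/2)`, so for `D` large they carry at most half of the lower bound `c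
  -- t^{-α/2}`. On the others `H = 1`.
  obtain ⟨D, hD, hDc⟩ : ∃ D > (0 : ℝ), Real.exp (-(D / 8)) * (C * 2 ^ (α / 2)) ≤ c / 2 := by
    have h1 : Tendsto (fun D : ℝ => Real.exp (-(D / 8)) * (C * 2 ^ (α / 2))) atTop (𝓝 (0 * (C * 2 ^ (α / 2)))) := by
      refine Tendsto.mul_const _ ?_
      exact Real.tendsto_exp_neg_atTop_nhds_zero.comp (tendsto_id.atTop_div_const (by norm_num))
    rw [zero_mul] at h1
    obtain ⟨D, h2, h3⟩ := ((h1.eventually (ge_mem_nhds (show (0 : ℝ) < c / 2 by positivity))).and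
      (eventually_gt_atTop 0)).exists
    exact ⟨D, h3, h2⟩
  refine ⟨c / 2 * D ^ (-(α / 2)), by positivity, √D + 1, by linarith [Real.sqrt_nonneg D],
    fun L hL x => ?_⟩
  have hL0 : 0 < L := by linarith [Real.sqrt_nonneg D]
  set t := D / L ^ 2 with ht
  have ht0 : 0 < t := by positivity
  have ht1 : t < 1 := by
    rw [ht, div_lt_one (by positivity)]
    have : √D < L := by linarith
    calc D = √D ^ 2 := (Real.sq_sqrt hD.le).symm
      _ < L ^ 2 := by gcongr
  have hpow : t ^ (-(α / 2)) = D ^ (-(α / 2)) * L ^ α := by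
    rw [ht, Real.div_rpow hD.le (by positivity), Real.rpow_neg (by positivity : (0 : ℝ) ≤ L ^ 2),
      ← Real.rpow_natCast L 2, ← Real.rpow_mul hL0.le, div_inv_eq_mul]
    congr 2
    push_cast; ring
  have hpow2 : (t / 2) ^ (-(α / 2)) = 2 ^ (α / 2) * t ^ (-(α / 2)) := by
    rw [Real.div_rpow ht0.le (by norm_num), Real.rpow_neg (by norm_num : (0 : ℝ) ≤ 2), div_inv_eq_mul]
    ring
  have hLt : L ^ 2 * t / 8 = D / 8 := by rw [ht]; field_simp
  have e : heatKernel φ lam t x x = ∑' k, Real.exp (-(lam k) ^ 2 * t) * φ k x ^ 2 := by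
    unfold heatKernel; congr 1; funext k; ring
  have hHs : Summable fun k => H (lam k / L) ^ 2 * φ k x ^ 2 :=
    summable_of_hasFiniteSupport ((hX.spectral.lowFreq L).finite_toSet.subset fun k hk => by
      by_contra hk'
      apply hk
      simp [hX.spectral.filter_eq_zero hH hL0 hk'])
  have hHe : ∑' k, H (lam k / L) ^ 2 * φ k x ^ 2 =
      ∑ k ∈ hX.spectral.lowFreq L, H (lam k / L) ^ 2 * φ k x ^ 2 :=
    tsum_eq_sum fun k hk => by simp [hX.spectral.filter_eq_zero hH hL0 hk]
  have hs2 := (hX.summable_diag x (half_pos ht0)).mul_left (Real.exp (-(D / 8)))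
  have hmain : ∑' k, Real.exp (-(lam k) ^ 2 * t) * φ k x ^ 2 ≤
      ∑' k, (H (lam k / L) ^ 2 * φ k x ^ 2 +
        Real.exp (-(D / 8)) * (Real.exp (-(lam k) ^ 2 * (t / 2)) * φ k x ^ 2)) := by
    refine (hX.summable_diag x ht0).tsum_le_tsum (fun k => ?_) (hHs.add hs2)
    rw [← mul_assoc, ← add_mul, ← Real.exp_add]
    gcongr
    have hl := hX.spectral.lam_nonneg k
    rcases le_or_gt (lam k / L) (1 / 2) with h | h
    · rw [hH.eq_one _ (by positivity) h]
      have : Real.exp (-(lam k) ^ 2 * t) ≤ 1 := Real.exp_le_one_iff.2 (by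
        have : 0 ≤ (lam k) ^ 2 * t := by positivity
        linarith)
      have := Real.exp_pos (-(D / 8) + -(lam k) ^ 2 * (t / 2))
      linarith
    · refine le_add_of_nonneg_of_le (sq_nonneg _) (Real.exp_le_exp.2 ?_)
      rw [← hLt]
      have h' : L / 2 < lam k := by rw [lt_div_iff₀ hL0] at h; linarith
      have : (L / 2) ^ 2 ≤ lam k ^ 2 := by gcongr
      nlinarith
  rw [hHs.tsum_add hs2, tsum_mul_left, hHe] at hmain
  have h1 := hlow x t ht0 ht1
  rw [e] at h1
  have h2 := hup x (t / 2) (by positivity) (by linarith)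
  have h3 : Real.exp (-(D / 8)) * ∑' k, Real.exp (-(lam k) ^ 2 * (t / 2)) * φ k x ^ 2 ≤
      c / 2 * t ^ (-(α / 2)) := by
    calc _ ≤ Real.exp (-(D / 8)) * (C * (2 ^ (α / 2) * t ^ (-(α / 2)))) := by
          rw [← hpow2]; gcongr
      _ = Real.exp (-(D / 8)) * (C * 2 ^ (α / 2)) * t ^ (-(α / 2)) := by ring
      _ ≤ _ := by gcongr
  calc _ = c / 2 * t ^ (-(α / 2)) := by rw [hpow]; ring
    _ ≤ _ := by linarith

/-- Polynomial localization of the low pass kernels, up to a bounded term. -/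
theorem IsDiffusionMeasureSpace.exists_abs_lowPassKernel_le
    (hX : IsDiffusionMeasureSpace ρ μ φ lam α) (hH : IsLowPass H) {m : ℕ} (hm : α ≤ m) :
    ∃ C > 0, ∀ L ≥ 1, ∀ x y, |lowPassKernel φ lam H L x y| ≤ C * kernelWeight ρ α m L x y := by
  obtain ⟨C₁, hC₁, hup⟩ := hX.exists_tsum_abs_le
  obtain ⟨c, hc, C₂, hgauss⟩ := hX.heatKernel_upper
  obtain ⟨ψ, hψ, hψH⟩ := hH.exists_contDiff
  obtain ⟨C₃, hC₃, hmom⟩ := exists_abs_tsum_comp_mul_le hψ m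
  have hα := hX.alpha_pos
  -- This `δ` turns the Gaussian factor into `exp (-4 (n + 1))`. The four units of exponent pay for
  -- `7 ^ n ≤ exp (2n)`, `2n + 1 ≤ 2 exp n` and `n ^ m ≤ m! exp n`.
  set δ := √c / 2 with hδ
  have hδ0 : 0 < δ := by positivity
  have hcδ : c / δ ^ 2 = 4 := by
    rw [hδ, div_pow, Real.sq_sqrt hc.le]; field_simp; norm_num
  -- the uniform bound
  have hunif : ∀ L ≥ (1 : ℝ), ∀ x y,
      |lowPassKernel φ lam H L x y| ≤ Real.exp 1 * C₁ * L ^ α := by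
    intro L hL x y
    have hL0 : 0 < L := by linarith
    have hs := hX.summable_abs x y (t := 1 / L ^ 2) (by positivity)
    have h1 := hup x y (1 / L ^ 2) (by positivity) (by
      rw [div_le_one (by positivity)]; exact one_le_pow₀ hL)
    have hpow : (1 / L ^ 2) ^ (-(α / 2)) = L ^ α := by
      rw [one_div, Real.inv_rpow (by positivity), Real.rpow_neg (by positivity), inv_inv,
        ← Real.rpow_natCast L 2, ← Real.rpow_mul hL0.le]
      congr 1; push_cast; ring
    rw [hpow] at h1
    have h2 : ‖lowPassKernel φ lam H L x y‖ ≤ Real.exp 1 *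
        ∑' k, |Real.exp (-(lam k) ^ 2 * (1 / L ^ 2)) * φ k x * φ k y| := by
      rw [← tsum_mul_left]
      refine tsum_of_norm_bounded (hs.mul_left _).hasSum fun k => ?_
      have e1 : ‖H (lam k / L) * φ k x * φ k y‖ = |H (lam k / L)| * |φ k x * φ k y| := by
        rw [Real.norm_eq_abs, mul_assoc, abs_mul]
      have e2 : Real.exp 1 * |Real.exp (-(lam k) ^ 2 * (1 / L ^ 2)) * φ k x * φ k y| =
          Real.exp 1 * |Real.exp (-(lam k) ^ 2 * (1 / L ^ 2))| * |φ k x * φ k y| := by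
        rw [mul_assoc (Real.exp _) (φ k x), abs_mul, mul_assoc]
      rw [e1, e2]
      refine mul_le_mul_of_nonneg_right ?_ (abs_nonneg _)
      have hl := hX.spectral.lam_nonneg k
      have hl' : 0 ≤ lam k / L := by positivity
      rw [abs_of_nonneg (hH.nonneg hl'), abs_of_pos (Real.exp_pos _), ← Real.exp_add]
      rcases le_or_gt 1 (lam k / L) with h | h
      · rw [hH.eq_zero _ h]; positivity
      · refine (hH.le_one hl').trans (Real.one_le_exp ?_)
        have : (lam k / L) ^ 2 ≤ 1 := pow_le_one₀ hl' h.le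
        rw [div_pow] at this
        have e : -(lam k) ^ 2 * (1 / L ^ 2) = -(lam k ^ 2 / L ^ 2) := by ring
        rw [e]; linarith
    rw [← Real.norm_eq_abs]
    calc _ ≤ _ := h2
      _ ≤ Real.exp 1 * (C₁ * L ^ α) := by gcongr
      _ = _ := by ring
  set K₁ := C₃ * (2 * |C₂| * m.factorial + C₁) with hK₁
  set K₂ := Real.exp 1 * C₁ with hK₂
  have hK₁0 : 0 < K₁ := by positivity
  have hK₂0 : 0 < K₂ := by positivity
  -- the main estimate
  have hmain : ∀ L ≥ (1 : ℝ), ∀ x y, ∀ n : ℕ, 1 ≤ n → (n : ℝ) + 1 ≤ L ^ 2 →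
      (n : ℝ) + 1 ≤ δ * (L * ρ x y) → |lowPassKernel φ lam H L x y| ≤ K₁ * (L ^ α / n ^ m) := by
    intro L hL x y n hn hnL hnρ
    have hL0 : 0 < L := by linarith
    have hn0 : (0 : ℝ) < n := by exact_mod_cast hn
    -- One Gaussian factor stays in `b` to make it absolutely summable; the `i`-th moment is then
    -- the heat kernel at time `(i + 1) / L²`. The condition `n + 1 ≤ L²` keeps these times within
    -- `(0, 1]`.
    set u : ℕ → ℝ := fun k => Real.exp (-(lam k / L) ^ 2) with hu
    set b : ℕ → ℝ := fun k => Real.exp (-(lam k) ^ 2 * (1 / L ^ 2)) * φ k x * φ k y with hb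
    have hub : ∀ k, u k = Real.exp (-(lam k) ^ 2 * (1 / L ^ 2)) := fun k => by
      simp only [hu]; congr 1; rw [div_pow]; ring
    have hs := hX.summable_abs x y (t := 1 / L ^ 2) (by positivity)
    have hpow : (1 / L ^ 2) ^ (-(α / 2)) = L ^ α := by
      rw [one_div, Real.inv_rpow (by positivity), Real.rpow_neg (by positivity), inv_inv,
        ← Real.rpow_natCast L 2, ← Real.rpow_mul hL0.le]
      congr 1; push_cast; ring
    have h1 := hup x y (1 / L ^ 2) (by positivity) (by
      rw [div_le_one (by positivity)]; exact one_le_pow₀ hL)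
    rw [hpow] at h1
    have hM : ∀ i ≤ n, |∑' k, u k ^ i * b k| ≤ |C₂| * L ^ α * Real.exp (-(4 * (n + 1))) := by
      intro i hi
      have hi' : (i : ℝ) ≤ n := by exact_mod_cast hi
      have e : ∑' k, u k ^ i * b k = heatKernel φ lam ((i + 1) / L ^ 2) x y := by
        unfold heatKernel
        congr 1; funext k
        simp only [hb]
        rw [hub, ← Real.exp_nat_mul, ← mul_assoc, ← mul_assoc, ← Real.exp_add]
        congr 3; ring
      rw [e]
      refine (hgauss x y _ (by positivity) ?_).trans ?_
      · rw [div_le_one (by positivity)]; linarith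
      · have q1 : ((i + 1) / L ^ 2) ^ (-(α / 2)) ≤ L ^ α := by
          rw [← hpow]
          refine Real.rpow_le_rpow_of_nonpos (by positivity) ?_ (by linarith)
          gcongr
          linarith [(Nat.cast_nonneg i : (0 : ℝ) ≤ i)]
        have q2 : 4 * ((n : ℝ) + 1) ≤ c * (ρ x y ^ 2 / ((i + 1) / L ^ 2)) := by
          have h3 : ((n : ℝ) + 1) ^ 2 ≤ (δ * (L * ρ x y)) ^ 2 := by gcongr
          rw [← hcδ]
          have h4 : c * (ρ x y ^ 2 / ((i + 1) / L ^ 2)) = c / δ ^ 2 * ((δ * (L * ρ x y)) ^ 2 / (i + 1)) := by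
            field_simp
          rw [h4]
          gcongr
          rw [le_div_iff₀ (by positivity)]
          nlinarith
        calc _ ≤ |C₂| * (((i + 1) / L ^ 2) ^ (-(α / 2)) * Real.exp (-(c * (ρ x y ^ 2 / ((i + 1) / L ^ 2))))) := by
              gcongr; exact le_abs_self _
          _ ≤ |C₂| * (L ^ α * Real.exp (-(4 * (n + 1)))) := by gcongr
          _ = _ := by ring
    have h5 := hmom u b (fun k => ⟨(Real.exp_pos _).le, Real.exp_le_one_iff.2 (by
      have := sq_nonneg (lam k / L); linarith)⟩) hs _ n hn hM
    have e : ∑' k, ψ (u k) * b k = lowPassKernel φ lam H L x y := by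
      unfold lowPassKernel
      congr 1; funext k
      have := hX.spectral.lam_nonneg k
      rw [← hψH (lam k / L) (by positivity)]
      simp only [hb]
      rw [← hub]
      simp only [hu]
      ring
    rw [e] at h5
    refine h5.trans ?_
    have g1 : (7 : ℝ) ^ n * (2 * n + 1) * Real.exp (-(4 * (n + 1))) ≤ 2 * m.factorial / n ^ m := by
      have a1 : (7 : ℝ) ≤ Real.exp 2 := by
        have := Real.exp_one_gt_d9
        have e2 : Real.exp 2 = Real.exp 1 ^ 2 := by rw [← Real.exp_nat_mul]; norm_num
        rw [e2]; nlinarith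
      have a2 : (7 : ℝ) ^ n ≤ Real.exp (2 * n) := by
        calc (7 : ℝ) ^ n ≤ Real.exp 2 ^ n := by gcongr
          _ = _ := by rw [← Real.exp_nat_mul]; ring_nf
      have a3 : (2 * n + 1 : ℝ) ≤ 2 * Real.exp n := by
        have := Real.add_one_le_exp (n : ℝ); linarith
      have a4 : (n : ℝ) ^ m / m.factorial ≤ Real.exp n := Real.pow_div_factorial_le_exp _ hn0.le m
      have a5 : (n : ℝ) ^ m ≤ m.factorial * Real.exp n := by
        rw [div_le_iff₀ (by positivity)] at a4; linarith
      rw [le_div_iff₀ (by positivity)]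
      calc _ ≤ Real.exp (2 * n) * (2 * Real.exp n) * Real.exp (-(4 * (n + 1))) * (m.factorial * Real.exp n) := by
            gcongr
        _ = 2 * m.factorial * Real.exp (2 * n + n + -(4 * (n + 1)) + n) := by
            simp only [Real.exp_add]; ring
        _ ≤ 2 * m.factorial * 1 := by
            gcongr
            rw [Real.exp_le_one_iff]; linarith
        _ = _ := by ring
    have hLα : 0 < L ^ α := by positivity
    calc _ = C₃ * (|C₂| * L ^ α * (7 ^ n * (2 * n + 1) * Real.exp (-(4 * (n + 1)))) + (∑' k, |b k|) / n ^ m) := by ring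
      _ ≤ C₃ * (|C₂| * L ^ α * (2 * m.factorial / n ^ m) + C₁ * L ^ α / n ^ m) := by gcongr
      _ = _ := by rw [hK₁]; ring
  -- The summands serve the cases `L² < 2`, `δ L ρ < 2`, and both at least `2`. The first two need
  -- only the uniform bound.
  refine ⟨K₂ * (2 ^ α + (1 + 2 / δ) ^ m) + K₁ * 3 ^ m * (1 + ((1 + δ) / δ) ^ m), by positivity,
    fun L hL x y => ?_⟩
  have hL0 : 0 < L := by linarith
  have hLα : 0 < L ^ α := by positivity
  have hρ := hX.quasiMetric.nonneg x y
  have hLρ : 0 ≤ L * ρ x y := by positivity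
  set w := kernelWeight ρ α m L x y with hw
  have hw1 : 1 ≤ w := by
    rw [hw, kernelWeight]
    have : 0 ≤ L ^ α / (1 + L * ρ x y) ^ m := by positivity
    linarith
  have hw2 : L ^ α / (1 + L * ρ x y) ^ m ≤ w := by rw [hw, kernelWeight]; linarith
  have p1 : 0 ≤ K₂ * 2 ^ α * w := by positivity
  have p2 : 0 ≤ K₂ * (1 + 2 / δ) ^ m * w := by positivity
  have p3 : 0 ≤ K₁ * 3 ^ m * (1 + ((1 + δ) / δ) ^ m) * w := by positivity
  rw [add_mul, mul_add, add_mul]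
  rcases lt_or_ge (L ^ 2) 2 with h2 | h2
  · have : L ^ α ≤ 2 ^ α := by
      gcongr; nlinarith
    have := hunif L hL x y
    have : K₂ * L ^ α ≤ K₂ * 2 ^ α * w := by
      calc _ ≤ K₂ * 2 ^ α := by gcongr
        _ ≤ _ := le_mul_of_one_le_right (by positivity) hw1
    linarith
  rcases lt_or_ge (δ * (L * ρ x y)) 2 with h3 | h3
  · have q : 1 + L * ρ x y ≤ 1 + 2 / δ := by
      have : L * ρ x y ≤ 2 / δ := by rw [le_div_iff₀ hδ0]; linarith
      linarith
    have := hunif L hL x y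
    have : K₂ * L ^ α ≤ K₂ * (1 + 2 / δ) ^ m * w := by
      calc K₂ * L ^ α = K₂ * (1 + L * ρ x y) ^ m * (L ^ α / (1 + L * ρ x y) ^ m) := by
            field_simp
        _ ≤ _ := by gcongr
    linarith
  -- The largest admissible degree is `n = ⌊R⌋ - 1`, comparable to `R`. If `R = L²`, the estimate
  -- only gives `L^α / L^{2m} ≤ 1`, which is the origin of the `+ 1` in `kernelWeight`.
  set R := min (L ^ 2) (δ * (L * ρ x y)) with hR
  have hR2 : 2 ≤ R := le_min h2 h3
  obtain ⟨n, hn⟩ : ∃ n : ℕ, ⌊R⌋₊ = n + 1 := by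
    refine ⟨⌊R⌋₊ - 1, ?_⟩
    have : 2 ≤ ⌊R⌋₊ := Nat.le_floor (by exact_mod_cast hR2)
    omega
  have hn1 : 1 ≤ n := by
    have : 2 ≤ ⌊R⌋₊ := Nat.le_floor (by exact_mod_cast hR2)
    omega
  have hnR : (n : ℝ) + 1 ≤ R := by
    have := Nat.floor_le (a := R) (by linarith)
    rw [hn] at this; exact_mod_cast this
  have hRn : R ≤ 3 * n := by
    have := Nat.lt_floor_add_one R
    rw [hn] at this
    push_cast at this
    have : (1 : ℝ) ≤ n := by exact_mod_cast hn1
    linarith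
  have hn0 : (0 : ℝ) < n := by exact_mod_cast hn1
  have h4 := hmain L hL x y n hn1 (hnR.trans (min_le_left _ _)) (hnR.trans (min_le_right _ _))
  have h5 : L ^ α / (n : ℝ) ^ m ≤ 3 ^ m * (L ^ α / R ^ m) := by
    rw [mul_div_assoc', div_le_div_iff₀ (by positivity) (by positivity)]
    calc L ^ α * R ^ m ≤ L ^ α * (3 * n) ^ m := by gcongr
      _ = _ := by rw [mul_pow]; ring
  have h6 : L ^ α / R ^ m ≤ (1 + ((1 + δ) / δ) ^ m) * w := by
    rw [add_mul, one_mul]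
    rcases min_choice (L ^ 2) (δ * (L * ρ x y)) with h | h
    · rw [hR, h]
      have : L ^ α / (L ^ 2) ^ m ≤ 1 := by
        rw [div_le_one (by positivity), ← pow_mul]
        calc L ^ α ≤ L ^ ((2 * m : ℕ) : ℝ) := by
              refine Real.rpow_le_rpow_of_exponent_le hL ?_
              push_cast
              linarith [(Nat.cast_nonneg m : (0 : ℝ) ≤ m)]
          _ = _ := Real.rpow_natCast _ _
      have : 0 ≤ ((1 + δ) / δ) ^ m * w := by positivity
      linarith
    · rw [hR, h]
      have hp : 0 < δ * (L * ρ x y) := by linarith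
      have : L ^ α / (δ * (L * ρ x y)) ^ m ≤ ((1 + δ) / δ) ^ m * (L ^ α / (1 + L * ρ x y) ^ m) := by
        rw [mul_div_assoc', div_le_div_iff₀ (by positivity) (by positivity)]
        calc L ^ α * (1 + L * ρ x y) ^ m ≤ L ^ α * ((1 + δ) / δ * (δ * (L * ρ x y))) ^ m := by
              gcongr
              have : (1 + δ) / δ * (δ * (L * ρ x y)) = L * ρ x y + δ * (L * ρ x y) := by
                field_simp
              linarith
          _ = _ := by rw [mul_pow]; ring
      have : ((1 + δ) / δ) ^ m * (L ^ α / (1 + L * ρ x y) ^ m) ≤ ((1 + δ) / δ) ^ m * w := by gcongr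
      linarith
  have h7 : K₁ * (L ^ α / (n : ℝ) ^ m) ≤ K₁ * 3 ^ m * (1 + ((1 + δ) / δ) ^ m) * w := by
    calc _ ≤ K₁ * (3 ^ m * ((1 + ((1 + δ) / δ) ^ m) * w)) := by
          gcongr; exact h5.trans (by gcongr)
      _ = _ := by ring
  linarith

end DiffusionQuantization

/-! ### Integrals of the weight and lower bounds for the kernels. -/

namespace DiffusionQuantization

theorem IsQuasiMetric.exists_one_le {X : Type*} [TopologicalSpace X] {ρ : X → X → ℝ}
    (h : IsQuasiMetric ρ) : ∃ A : ℝ, 1 ≤ A ∧ ∀ x y z, ρ x z ≤ A * (ρ x y + ρ y z) := by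
  obtain ⟨A, hA⟩ := h.quasi_triangle
  refine ⟨max A 1, le_max_right _ _, fun x y z => (hA x y z).trans ?_⟩
  exact mul_le_mul_of_nonneg_right (le_max_left _ _) (add_nonneg (h.nonneg _ _) (h.nonneg _ _))

theorem IsQuasiMetric.t2Space {X : Type*} [TopologicalSpace X] {ρ : X → X → ℝ}
    (h : IsQuasiMetric ρ) : T2Space X := by
  obtain ⟨A, hA1, hA⟩ := h.exists_one_le
  rw [t2Space_iff_disjoint_nhds]
  intro x y hxy
  have hd : 0 < ρ x y := lt_of_le_of_ne (h.nonneg _ _) fun e => hxy ((h.eq_zero_iff x y).1 e.symm)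
  rw [(h.nhds_basis x).disjoint_iff (h.nhds_basis y)]
  refine ⟨ρ x y / (2 * A), by positivity, ρ x y / (2 * A), by positivity, ?_⟩
  rw [Set.disjoint_left]
  intro z hz hz'
  simp only [Set.mem_ofPred_eq] at hz hz'
  have h1 := hA x z y
  rw [h.symm z y] at h1
  have h2 : A * (ρ x z + ρ y z) < A * (ρ x y / (2 * A) + ρ x y / (2 * A)) := by gcongr
  have h3 : A * (ρ x y / (2 * A) + ρ x y / (2 * A)) = ρ x y := by field_simp; ring
  linarith

variable {X : Type*} [TopologicalSpace X] [MeasurableSpace X] [BorelSpace X]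
  {ρ : X → X → ℝ} {μ : Measure X} {φ : ℕ → X → ℝ} {lam : ℕ → ℝ} {α : ℝ} {H : ℝ → ℝ}

/-- A quasi-metric need not be continuous. Its sublevel sets are nevertheless closed, being compact
in a Hausdorff space; nonpositive levels are treated apart because compactness is assumed only for
positive radii. -/
theorem IsDiffusionMeasureSpace.measurable_dist (hX : IsDiffusionMeasureSpace ρ μ φ lam α) (x : X) :
    Measurable (ρ x) := by
  have := hX.quasiMetric.t2Space
  refine measurable_of_Iic fun t => ?_
  rcases lt_trichotomy t 0 with h | h | h
  · have : ρ x ⁻¹' Set.Iic t = ∅ := by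
      ext y
      simp only [Set.mem_preimage, Set.mem_Iic, Set.mem_empty_iff_false, iff_false, not_le]
      exact h.trans_le (hX.quasiMetric.nonneg x y)
    rw [this]; exact MeasurableSet.empty
  · have : ρ x ⁻¹' Set.Iic t = {x} := by
      ext y
      simp only [Set.mem_preimage, Set.mem_Iic, Set.mem_singleton_iff]
      rw [h, @eq_comm _ y x, ← hX.quasiMetric.eq_zero_iff]
      exact ⟨fun h => le_antisymm h (hX.quasiMetric.nonneg _ _), fun h => h.le⟩
    rw [this]; exact isClosed_singleton.measurableSet
  · exact (hX.isCompact_closedBall x t h).isClosed.measurableSet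

theorem IsDiffusionMeasureSpace.measurable_kernelWeight (hX : IsDiffusionMeasureSpace ρ μ φ lam α)
    (m : ℕ) (L : ℝ) (x : X) : Measurable (kernelWeight ρ α m L x) := by
  have := hX.measurable_dist x
  unfold kernelWeight
  fun_prop

omit [BorelSpace X] in
theorem IsDiffusionMeasureSpace.continuous_lowPassKernel
    (hX : IsDiffusionMeasureSpace ρ μ φ lam α) (hH : IsLowPass H) {L : ℝ} (hL : 0 < L) (x : X) :
    Continuous (lowPassKernel φ lam H L x) := by
  have e : lowPassKernel φ lam H L x =
      fun y => ∑ k ∈ hX.spectral.lowFreq L, H (lam k / L) * φ k x * φ k y :=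
    funext fun y => hX.spectral.lowPassKernel_eq_sum hH hL x y
  have := hX.spectral.continuous
  rw [e]
  fun_prop

omit [BorelSpace X] in
theorem IsDiffusionMeasureSpace.kernelWeight_pos (hX : IsDiffusionMeasureSpace ρ μ φ lam α) {m : ℕ}
    {L : ℝ} (hL : 0 < L) (x y : X) : 0 < kernelWeight ρ α m L x y := by
  have := hX.quasiMetric.nonneg x y
  unfold kernelWeight
  positivity

omit [BorelSpace X] in
theorem IsDiffusionMeasureSpace.kernelWeight_le (hX : IsDiffusionMeasureSpace ρ μ φ lam α) {m : ℕ}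
    {L : ℝ} (hL : 0 < L) (x y : X) : kernelWeight ρ α m L x y ≤ L ^ α + 1 := by
  have := hX.quasiMetric.nonneg x y
  unfold kernelWeight
  gcongr
  refine div_le_self (by positivity) (one_le_pow₀ ?_)
  have : 0 ≤ L * ρ x y := by positivity
  linarith

omit [BorelSpace X] in
-- By the quasi-triangle inequality the weight varies slowly: moving a point by `K / L` changes it
-- by at most a constant factor.
theorem IsDiffusionMeasureSpace.kernelWeight_le_mul (hX : IsDiffusionMeasureSpace ρ μ φ lam α)
    {A : ℝ} (hA1 : 1 ≤ A) (hA : ∀ x y z, ρ x z ≤ A * (ρ x y + ρ y z)) {m : ℕ} {L K : ℝ} (hL : 0 < L)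
    (hK : 0 ≤ K) {y z : X} (hyz : L * ρ y z ≤ K) (x : X) :
    kernelWeight ρ α m L x y ≤ (A * (1 + K)) ^ m * kernelWeight ρ α m L x z := by
  have hxy := hX.quasiMetric.nonneg x y
  have hxz := hX.quasiMetric.nonneg x z
  have h1 : 1 + L * ρ x z ≤ A * (1 + K) * (1 + L * ρ x y) := by
    have h3 : L * ρ x z ≤ A * (L * ρ x y + L * ρ y z) := by
      calc _ ≤ L * (A * (ρ x y + ρ y z)) := by gcongr; exact hA x y z
        _ = _ := by ring
    have h5 : A * (L * ρ x y + L * ρ y z) ≤ A * (L * ρ x y + K) := by gcongr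
    have h6 : 0 ≤ A * (K * (L * ρ x y)) := by positivity
    linarith
  have h7 : 1 ≤ (A * (1 + K)) ^ m := one_le_pow₀ (one_le_mul_of_one_le_of_one_le hA1 (by linarith))
  unfold kernelWeight
  rw [mul_add, mul_one]
  refine add_le_add ?_ h7
  rw [mul_div_assoc', div_le_div_iff₀ (by positivity) (by positivity)]
  calc L ^ α * (1 + L * ρ x z) ^ m ≤ L ^ α * (A * (1 + K) * (1 + L * ρ x y)) ^ m := by gcongr
    _ = _ := by rw [mul_pow]; ring

omit [BorelSpace X] in
theorem IsDiffusionMeasureSpace.exists_abs_lowPassKernel_le_rpow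
    (hX : IsDiffusionMeasureSpace ρ μ φ lam α) (hH : IsLowPass H) :
    ∃ C > 0, ∀ L ≥ 1, ∀ x y, |lowPassKernel φ lam H L x y| ≤ C * L ^ α := by
  obtain ⟨m, hm⟩ := exists_nat_ge α
  obtain ⟨C, hC, h⟩ := hX.exists_abs_lowPassKernel_le hH hm
  refine ⟨2 * C, by positivity, fun L hL x y => (h L hL x y).trans ?_⟩
  have h1 := hX.kernelWeight_le (m := m) (lt_of_lt_of_le one_pos hL) x y
  have h2 : 1 ≤ L ^ α := Real.one_le_rpow hL hX.alpha_pos.le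
  nlinarith

omit [BorelSpace X] in
theorem IsSpectralSystem.integral_phi_mul (h : IsSpectralSystem μ φ lam) (i j : ℕ) :
    ∫ x, φ i x * φ j x ∂μ = if i = j then 1 else 0 := by
  have h1 := (orthonormal_iff_ite.1 h.orthonormal) i j
  rw [L2.inner_def] at h1
  rw [← h1]
  refine integral_congr_ae ?_
  filter_upwards [(h.memLp i).coeFn_toLp, (h.memLp j).coeFn_toLp] with x hi hj
  rw [hi, hj]
  simp [mul_comm]

variable [IsProbabilityMeasure μ]

theorem IsDiffusionMeasureSpace.integrable_kernelWeight (hX : IsDiffusionMeasureSpace ρ μ φ lam α)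
    (m : ℕ) {L : ℝ} (hL : 0 < L) (x : X) : Integrable (kernelWeight ρ α m L x) μ := by
  refine Integrable.of_bound (hX.measurable_kernelWeight m L x).aestronglyMeasurable (L ^ α + 1)
    (Eventually.of_forall fun y => ?_)
  rw [Real.norm_eq_abs, abs_of_pos (hX.kernelWeight_pos hL x y)]
  exact hX.kernelWeight_le hL x y

theorem IsDiffusionMeasureSpace.exists_integral_kernelWeight_le
    (hX : IsDiffusionMeasureSpace ρ μ φ lam α) {m : ℕ} (hm : α + 1 ≤ m) :
    ∃ C > 0, ∀ L > 0, ∀ x, ∫ y, kernelWeight ρ α m L x y ∂μ ≤ C := by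
  obtain ⟨C, hC⟩ := hX.measure_closedBall_le
  set C' := |C| with hC'
  refine ⟨2 * (2 ^ m * C') + 1, by positivity, fun L hL x => ?_⟩
  have hρm := hX.measurable_dist x
  set B : ℕ → Set X := fun j => {y | ρ x y ≤ 2 ^ j / L} with hB
  have hBm : ∀ j, MeasurableSet (B j) := fun j => hρm measurableSet_Iic
  have hBμ : ∀ j, μ.real (B j) ≤ C' * (2 ^ j / L) ^ α := fun j =>
    (hC x (2 ^ j / L) (by positivity)).trans (by gcongr; exact le_abs_self _)
  have hLα : 0 < L ^ α := by positivity
  -- A point with `2 ^ n ≤ 1 + L ρ < 2 ^ (n + 1)` is charged to the ball of index `n + 1`; the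
  -- factor `2 ^ m` repairs the shift. Since `m ≥ α + 1`, the integrals of the `F j` decay at least
  -- like `2 ^ (-j)`.
  set F : ℕ → X → ℝ := fun j => (B j).indicator fun _ => L ^ α * 2 ^ m / (2 ^ j) ^ m with hF
  have hFint : ∀ j, Integrable (F j) μ := fun j => (integrable_const _).indicator (hBm j)
  have hFval : ∀ j, ∫ y, F j y ∂μ ≤ 2 ^ m * C' * (1 / 2) ^ j := by
    intro j
    simp only [hF]
    rw [integral_indicator_const _ (hBm j), smul_eq_mul]
    have e1 : (2 ^ j / L) ^ α = ((2 : ℝ) ^ α) ^ j / L ^ α := by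
      rw [Real.div_rpow (by positivity) hL.le, ← Real.rpow_natCast, ← Real.rpow_natCast,
        ← Real.rpow_mul (by norm_num), ← Real.rpow_mul (by norm_num), mul_comm]
    have e2 : (2 : ℝ) ^ α / 2 ^ m ≤ 1 / 2 := by
      rw [div_le_div_iff₀ (by positivity) (by norm_num), one_mul]
      calc (2 : ℝ) ^ α * 2 = 2 ^ (α + 1) := by rw [Real.rpow_add_one (by norm_num)]
        _ ≤ 2 ^ (m : ℝ) := Real.rpow_le_rpow_of_exponent_le (by norm_num) hm
        _ = _ := Real.rpow_natCast _ _
    calc _ ≤ C' * (2 ^ j / L) ^ α * (L ^ α * 2 ^ m / (2 ^ j) ^ m) := by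
          gcongr; exact hBμ j
      _ = 2 ^ m * C' * ((2 : ℝ) ^ α / 2 ^ m) ^ j := by
          rw [e1, div_pow, ← pow_mul, ← pow_mul, mul_comm j m]; field_simp
      _ ≤ _ := by gcongr
  have hFnn : ∀ j y, 0 ≤ F j y := fun j y => Set.indicator_nonneg (fun _ _ => by positivity) y
  have hdom : ∀ y, L ^ α / (1 + L * ρ x y) ^ m ≤ (∑' j, ENNReal.ofReal (F j y)).toReal ∨
      ∑' j, ENNReal.ofReal (F j y) = ⊤ := by
    intro y
    by_cases htop : ∑' j, ENNReal.ofReal (F j y) = ⊤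
    · exact Or.inr htop
    left
    have hρ := hX.quasiMetric.nonneg x y
    have hv : 0 ≤ L * ρ x y := by positivity
    obtain ⟨n, hn1, hn2⟩ := exists_nat_pow_near (x := 1 + L * ρ x y) (y := (2 : ℝ)) (by linarith)
      (by norm_num)
    have hmem : y ∈ B (n + 1) := by
      simp only [hB, Set.mem_ofPred_eq]
      rw [le_div_iff₀ hL]; linarith
    have h1 : L ^ α / (1 + L * ρ x y) ^ m ≤ F (n + 1) y := by
      simp only [hF]
      rw [Set.indicator_of_mem hmem, div_le_div_iff₀ (by positivity) (by positivity), mul_assoc]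
      gcongr
      rw [← mul_pow]
      gcongr
      rw [pow_succ]; linarith
    refine h1.trans ?_
    rw [← ENNReal.ofReal_le_iff_le_toReal htop]
    exact ENNReal.le_tsum (f := fun j => ENNReal.ofReal (F j y)) (n + 1)
  have hdom' : ∀ y, ENNReal.ofReal (L ^ α / (1 + L * ρ x y) ^ m) ≤ ∑' j, ENNReal.ofReal (F j y) := by
    intro y
    rcases hdom y with h | h
    · exact ENNReal.ofReal_le_of_le_toReal h
    · rw [h]; exact le_top
  have hsum : ∫⁻ y, ENNReal.ofReal (L ^ α / (1 + L * ρ x y) ^ m) ∂μ ≤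
      ENNReal.ofReal (2 * (2 ^ m * C')) := by
    calc _ ≤ ∫⁻ y, ∑' j, ENNReal.ofReal (F j y) ∂μ := lintegral_mono hdom'
      _ = ∑' j, ∫⁻ y, ENNReal.ofReal (F j y) ∂μ := lintegral_tsum fun j =>
          (hFint j).aestronglyMeasurable.aemeasurable.ennreal_ofReal
      _ ≤ ∑' j, ENNReal.ofReal (2 ^ m * C' * (1 / 2) ^ j) := by
          refine ENNReal.tsum_le_tsum fun j => ?_
          rw [← ofReal_integral_eq_lintegral_ofReal (hFint j) (Eventually.of_forall (hFnn j))]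
          exact ENNReal.ofReal_le_ofReal (hFval j)
      _ = ENNReal.ofReal (∑' j, 2 ^ m * C' * (1 / 2) ^ j) := by
          rw [ENNReal.ofReal_tsum_of_nonneg (fun j => by positivity)
            (summable_geometric_two.mul_left _)]
      _ = _ := by rw [tsum_mul_left, tsum_geometric_two, mul_comm]
  have hint : Integrable (fun y => L ^ α / (1 + L * ρ x y) ^ m) μ := by
    have := (hX.integrable_kernelWeight m hL x).sub (integrable_const (1 : ℝ))
    refine this.congr (Eventually.of_forall fun y => ?_)
    simp [kernelWeight]
  have h2 : ∫ y, L ^ α / (1 + L * ρ x y) ^ m ∂μ ≤ 2 * (2 ^ m * C') := by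
    rw [integral_eq_lintegral_of_nonneg_ae (Eventually.of_forall fun y => by
      have := hX.quasiMetric.nonneg x y
      simp only [Pi.zero_apply]; positivity) hint.aestronglyMeasurable]
    exact ENNReal.toReal_le_of_le_ofReal (by positivity) hsum
  have h3 : ∫ y, kernelWeight ρ α m L x y ∂μ = ∫ y, L ^ α / (1 + L * ρ x y) ^ m ∂μ + 1 := by
    unfold kernelWeight
    rw [integral_add hint (integrable_const _)]
    simp
  rw [h3]
  linarith

theorem IsDiffusionMeasureSpace.integrable_lowPassKernel
    (hX : IsDiffusionMeasureSpace ρ μ φ lam α) (hH : IsLowPass H) {L : ℝ} (hL : 1 ≤ L) (x : X) :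
    Integrable (lowPassKernel φ lam H L x) μ := by
  obtain ⟨C, hC, h⟩ := hX.exists_abs_lowPassKernel_le_rpow hH
  exact Integrable.of_bound
    (hX.continuous_lowPassKernel hH (one_pos.trans_le hL) x).measurable.aestronglyMeasurable _
    (Eventually.of_forall fun y => h L hL x y)

theorem IsDiffusionMeasureSpace.exists_integral_abs_lowPassKernel_le
    (hX : IsDiffusionMeasureSpace ρ μ φ lam α) (hH : IsLowPass H) :
    ∃ C > 0, ∀ L ≥ 1, ∀ x, ∫ y, |lowPassKernel φ lam H L x y| ∂μ ≤ C := by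
  obtain ⟨m, hm⟩ := exists_nat_ge (α + 1)
  obtain ⟨C, hC, h⟩ := hX.exists_abs_lowPassKernel_le hH (m := m) (by linarith)
  obtain ⟨C', hC', h'⟩ := hX.exists_integral_kernelWeight_le hm
  refine ⟨C * C', by positivity, fun L hL x => ?_⟩
  have hL0 : 0 < L := one_pos.trans_le hL
  calc _ ≤ ∫ y, C * kernelWeight ρ α m L x y ∂μ :=
        integral_mono (hX.integrable_lowPassKernel hH hL x).abs
          ((hX.integrable_kernelWeight m hL0 x).const_mul _) fun y => h L hL x y
    _ = C * ∫ y, kernelWeight ρ α m L x y ∂μ := integral_const_mul _ _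
    _ ≤ _ := by gcongr; exact h' L hL0 x

omit [BorelSpace X] [IsProbabilityMeasure μ] in
-- Parseval's identity; it turns the growth of the Christoffel function into a lower bound for the
-- `L₂` norm of the kernel.
theorem IsSpectralSystem.integral_lowPassKernel_sq (h : IsSpectralSystem μ φ lam)
    (hH : IsLowPass H) {L : ℝ} (hL : 0 < L) (x : X) :
    ∫ y, lowPassKernel φ lam H L x y ^ 2 ∂μ =
      ∑ k ∈ h.lowFreq L, H (lam k / L) ^ 2 * φ k x ^ 2 := by
  have hint : ∀ i j, Integrable (fun y => φ i y * φ j y) μ := fun i j =>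
    (h.memLp i).integrable_mul (h.memLp j)
  have e : ∀ y, lowPassKernel φ lam H L x y ^ 2 = ∑ i ∈ h.lowFreq L, ∑ j ∈ h.lowFreq L,
      (H (lam i / L) * φ i x * (H (lam j / L) * φ j x)) * (φ i y * φ j y) := by
    intro y
    rw [h.lowPassKernel_eq_sum hH hL, sq, Finset.sum_mul_sum]
    refine Finset.sum_congr rfl fun i _ => Finset.sum_congr rfl fun j _ => by ring
  simp_rw [e]
  rw [integral_finsetSum _ fun i _ => integrable_finsetSum _ fun j _ => (hint i j).const_mul _]
  refine Finset.sum_congr rfl fun i hi => ?_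
  rw [integral_finsetSum _ fun j _ => (hint i j).const_mul _]
  simp_rw [integral_const_mul, h.integral_phi_mul]
  simp [hi]
  ring

/-- `μ` charges every nonempty open set. -/
theorem IsDiffusionMeasureSpace.isOpenPosMeasure (hX : IsDiffusionMeasureSpace ρ μ φ lam α)
    (hH : IsLowPass H) : μ.IsOpenPosMeasure := by
  refine ⟨fun U hU ⟨x, hx⟩ hμU => ?_⟩
  obtain ⟨r, hr, hrU⟩ := (hX.quasiMetric.nhds_basis x).mem_iff.1 (hU.mem_nhds hx)
  obtain ⟨m, hm⟩ := exists_nat_ge α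
  obtain ⟨C, hC, h⟩ := hX.exists_abs_lowPassKernel_le hH hm
  obtain ⟨C', hC', h'⟩ := hX.exists_integral_abs_lowPassKernel_le hH
  obtain ⟨c, hc, L₁, hL₁, hlow⟩ := hX.exists_le_sum_sq hH
  -- At distance at least `r` from `x` the kernel is bounded by `K`, uniformly in `L`. Were `U`
  -- null, `∫ Φ_L²` would stay below `K ∫ |Φ_L|`, which is bounded, against its growth like `L ^ α`.
  set K := C * (1 / r ^ m + 1) with hK
  have hbound : ∀ L ≥ L₁, c * L ^ α ≤ K * C' := by
    intro L hL
    have hL1 : 1 ≤ L := hL₁.le.trans hL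
    have hL0 : 0 < L := one_pos.trans_le hL1
    refine (hlow L hL x).trans ?_
    rw [← hX.spectral.integral_lowPassKernel_sq hH hL0 x]
    have hint := (hX.integrable_lowPassKernel hH hL1 x).abs.const_mul K
    calc _ ≤ ∫ y, K * |lowPassKernel φ lam H L x y| ∂μ := by
          refine integral_mono_of_nonneg (Eventually.of_forall fun y => sq_nonneg _) hint ?_
          have hUae : ∀ᵐ y ∂μ, y ∉ U := measure_eq_zero_iff_ae_notMem.1 hμU
          filter_upwards [hUae] with y hy
          have hry : r ≤ ρ x y := by
            by_contra hlt
            exact hy (hrU (not_le.1 hlt))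
          rw [← sq_abs, sq]
          gcongr
          refine (h L hL1 x y).trans ?_
          rw [hK, kernelWeight]
          refine mul_le_mul_of_nonneg_left (add_le_add_left ?_ 1) hC.le
          have hry0 := hX.quasiMetric.nonneg x y
          rw [div_le_div_iff₀ (by positivity) (by positivity), one_mul]
          calc L ^ α * r ^ m ≤ L ^ m * r ^ m := by
                gcongr
                rw [← Real.rpow_natCast]
                exact Real.rpow_le_rpow_of_exponent_le hL1 hm
            _ = (L * r) ^ m := (mul_pow _ _ _).symm
            _ ≤ _ := by
                gcongr
                have : L * r ≤ L * ρ x y := by gcongr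
                linarith
      _ = K * ∫ y, |lowPassKernel φ lam H L x y| ∂μ := integral_const_mul _ _
      _ ≤ _ := by gcongr; exact h' L hL1 x
  have ht : Tendsto (fun L : ℝ => c * L ^ α) atTop atTop :=
    (tendsto_rpow_atTop hX.alpha_pos).const_mul_atTop hc
  obtain ⟨L, h1, h2⟩ := ((ht.eventually_gt_atTop (K * C')).and (eventually_ge_atTop L₁)).exists
  exact absurd (hbound L h2) (not_le.2 h1)

set_option maxHeartbeats 800000 in
/-- Reproduction of the weight by averages of the kernel. -/
theorem IsDiffusionMeasureSpace.exists_kernelWeight_mul_le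
    (hX : IsDiffusionMeasureSpace ρ μ φ lam α) (hH : IsLowPass H) {m : ℕ} (hm : α + 1 ≤ m)
    {q : ℝ} (hq : 1 ≤ q) :
    ∃ C > 0, ∃ L₁ ≥ 1, ∀ L ≥ L₁, ∀ x y,
      kernelWeight ρ α m L x y * (L ^ α) ^ (q - 1) ≤
        C * ∫ z, kernelWeight ρ α m L x z * |lowPassKernel φ lam H L z y| ^ q ∂μ := by
  obtain ⟨A, hA1, hA⟩ := hX.quasiMetric.exists_one_le
  obtain ⟨C₀, hC₀, hker⟩ := hX.exists_abs_lowPassKernel_le hH (m := m) (by linarith)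
  obtain ⟨C₁, hC₁, hkerM⟩ := hX.exists_abs_lowPassKernel_le_rpow hH
  obtain ⟨C₂, hC₂, hkerI⟩ := hX.exists_integral_abs_lowPassKernel_le hH
  obtain ⟨c, hc, L₁, hL₁, hlow⟩ := hX.exists_le_sum_sq hH
  obtain ⟨C₃', hC₃'⟩ := hX.measure_closedBall_le
  have hα := hX.alpha_pos
  have hm1 : 1 ≤ m := by
    have : (0 : ℝ) < m := by linarith
    exact_mod_cast this
  set C₃ := |C₃'| + 1 with hC₃
  have hC₃0 : 0 < C₃ := by positivity
  -- Of `∫ Φ_L(y,·)² ≥ c M`, the part outside the ball of radius `K / L` is at most `c M / 2`: a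
  -- quarter by the choice of `K`, a quarter from the `+ 1` of the weight once `L ≥ L₂`.
  set K := 4 * C₀ * C₂ / c with hK
  have hK0 : 0 < K := by positivity
  have hK1 : C₀ * C₂ / (1 + K) ^ m ≤ c / 4 := by
    rw [div_le_iff₀ (by positivity)]
    have h1 : 1 + K ≤ (1 + K) ^ m := le_self_pow₀ (by linarith) (by omega)
    calc C₀ * C₂ = c / 4 * K := by rw [hK]; field_simp
      _ ≤ c / 4 * (1 + K) ^ m := by gcongr; linarith
  -- Inside the ball, points with `|Φ_L| ≤ θ M` contribute at most another `c M / 4`. At the others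
  -- `|Φ_L|` lies between `θ M` and `C₁ M`, so its square is at most `D M^{2-q} |Φ_L|^q`, for `q` on
  -- either side of `2`.
  set θ := √(c / (4 * C₃ * K ^ α)) with hθ
  have hθ0 : 0 < θ := by positivity
  have hθ2 : θ ^ 2 * (C₃ * K ^ α) = c / 4 := by
    rw [hθ, Real.sq_sqrt (by positivity)]
    field_simp
  set D := C₁ ^ 2 / θ ^ q with hD
  have hD0 : 0 < D := by positivity
  obtain ⟨L₂, hL₂⟩ := ((tendsto_rpow_atTop hα).eventually_ge_atTop
    (4 * C₀ * C₂ / c)).exists_forall_of_atTop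
  refine ⟨4 * D / c * (A * (1 + K)) ^ m, by positivity, max L₁ L₂, le_max_of_le_left hL₁,
    fun L hL x y => ?_⟩
  have hLL₁ : L₁ ≤ L := (le_max_left _ _).trans hL
  have hL1 : 1 ≤ L := hL₁.le.trans hLL₁
  have hL0 : 0 < L := one_pos.trans_le hL1
  set M := L ^ α with hM
  have hM0 : 0 < M := by positivity
  have hMbig : C₀ * C₂ ≤ c / 4 * M := by
    have := hL₂ L ((le_max_right _ _).trans hL)
    rw [div_le_iff₀ hc] at this
    linarith
  set g : X → ℝ := fun z => |lowPassKernel φ lam H L y z| with hg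
  have hgmeas : Measurable g :=
    (hX.continuous_lowPassKernel hH hL0 y).abs.measurable
  have hg0 : ∀ z, 0 ≤ g z := fun z => abs_nonneg _
  have hgM : ∀ z, g z ≤ C₁ * M := fun z => hkerM L hL1 y z
  set B : Set X := {z | ρ y z ≤ K / L} with hB
  have hBm : MeasurableSet B := hX.measurable_dist y measurableSet_Iic
  have hμB : μ.real B ≤ C₃ * K ^ α / M := by
    refine (hC₃' y (K / L) (by positivity)).trans ?_
    rw [Real.div_rpow hK0.le hL0.le, mul_div_assoc]
    gcongr
    rw [hC₃]; linarith [le_abs_self C₃']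
  have hgq : Integrable (fun z => g z ^ q) μ := by
    refine Integrable.of_bound (hgmeas.pow_const q).aestronglyMeasurable ((C₁ * M) ^ q)
      (Eventually.of_forall fun z => ?_)
    rw [Real.norm_eq_abs, abs_of_nonneg (Real.rpow_nonneg (hg0 z) q)]
    exact Real.rpow_le_rpow (hg0 z) (hgM z) (by linarith)
  have hgqB : Integrable (B.indicator fun z => g z ^ q) μ := hgq.indicator hBm
  have hptw : ∀ z, lowPassKernel φ lam H L y z ^ 2 ≤
      B.indicator (fun _ => θ ^ 2 * M ^ 2) z + D * M ^ (2 - q) * B.indicator (fun z => g z ^ q) z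
        + C₀ * (M / (1 + K) ^ m + 1) * g z := by
    intro z
    have hsq : lowPassKernel φ lam H L y z ^ 2 = g z ^ 2 := (sq_abs _).symm
    rw [hsq]
    have hz0 := hg0 z
    have hlast : 0 ≤ C₀ * (M / (1 + K) ^ m + 1) * g z := by positivity
    by_cases hzB : z ∈ B
    · rw [Set.indicator_of_mem hzB, Set.indicator_of_mem hzB]
      have hmid : 0 ≤ D * M ^ (2 - q) * g z ^ q := by positivity
      rcases le_or_gt (g z) (θ * M) with hle | hgt
      · have : g z ^ 2 ≤ (θ * M) ^ 2 := by gcongr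
        rw [mul_pow] at this
        linarith
      · have h1 : (θ * M) ^ q ≤ g z ^ q :=
          Real.rpow_le_rpow (by positivity) hgt.le (by linarith)
        have h2 : g z ^ 2 ≤ D * M ^ (2 - q) * g z ^ q := by
          calc g z ^ 2 ≤ (C₁ * M) ^ 2 := by gcongr; exact hgM z
            _ = D * M ^ (2 - q) * (θ * M) ^ q := by
              rw [Real.mul_rpow hθ0.le hM0.le, Real.rpow_sub hM0, hD, mul_pow, Real.rpow_two]
              field_simp
            _ ≤ _ := by gcongr
        have : 0 ≤ θ ^ 2 * M ^ 2 := by positivity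
        linarith
    · rw [Set.indicator_of_notMem hzB, Set.indicator_of_notMem hzB, mul_zero, add_zero, zero_add,
        sq]
      gcongr
      refine (hker L hL1 y z).trans ?_
      have hlt : K < L * ρ y z := by
        have : K / L < ρ y z := not_le.1 hzB
        rw [div_lt_iff₀ hL0] at this
        linarith
      unfold kernelWeight
      gcongr
  have hmain : c * M ≤ θ ^ 2 * M ^ 2 * μ.real B
      + D * M ^ (2 - q) * ∫ z, B.indicator (fun z => g z ^ q) z ∂μ
        + C₀ * (M / (1 + K) ^ m + 1) * C₂ := by
    refine (hlow L hLL₁ y).trans ?_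
    rw [← hX.spectral.integral_lowPassKernel_sq hH hL0 y]
    have i1 : Integrable (B.indicator fun _ : X => θ ^ 2 * M ^ 2) μ :=
      (integrable_const _).indicator hBm
    have i2 := hgqB.const_mul (D * M ^ (2 - q))
    have i3 := (hX.integrable_lowPassKernel hH hL1 y).abs.const_mul
      (C₀ * (M / (1 + K) ^ m + 1))
    calc _ ≤ ∫ z, (B.indicator (fun _ => θ ^ 2 * M ^ 2) z
            + D * M ^ (2 - q) * B.indicator (fun z => g z ^ q) z
            + C₀ * (M / (1 + K) ^ m + 1) * g z) ∂μ :=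
          integral_mono_of_nonneg (Eventually.of_forall fun z => sq_nonneg _)
            ((i1.add i2).add i3) (Eventually.of_forall hptw)
      _ = θ ^ 2 * M ^ 2 * μ.real B + D * M ^ (2 - q) * ∫ z, B.indicator (fun z => g z ^ q) z ∂μ
            + C₀ * (M / (1 + K) ^ m + 1) * ∫ z, g z ∂μ := by
          have e1 := integral_add (i1.add i2) i3
          have e2 := integral_add i1 i2
          simp only [Pi.add_apply] at e1 e2
          rw [e1, e2, integral_const_mul, integral_const_mul, integral_indicator_const _ hBm,
            smul_eq_mul, mul_comm (μ.real B)]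
      _ ≤ _ := by gcongr; exact hkerI L hL1 y
  have hcore : M ^ (q - 1) ≤ 4 * D / c * ∫ z, B.indicator (fun z => g z ^ q) z ∂μ := by
    set J := ∫ z, B.indicator (fun z => g z ^ q) z ∂μ with hJ
    have h1 : θ ^ 2 * M ^ 2 * μ.real B ≤ c / 4 * M := by
      calc _ ≤ θ ^ 2 * M ^ 2 * (C₃ * K ^ α / M) := by gcongr
        _ = θ ^ 2 * (C₃ * K ^ α) * M := by field_simp
        _ = _ := by rw [hθ2]
    have h2 : C₀ * (M / (1 + K) ^ m + 1) * C₂ ≤ c / 2 * M := by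
      calc _ = C₀ * C₂ / (1 + K) ^ m * M + C₀ * C₂ := by field_simp
        _ ≤ c / 4 * M + c / 4 * M := by gcongr
        _ = _ := by ring
    have h3 : c / 4 * M ≤ D * M ^ (2 - q) * J := by linarith
    have h4 : M ^ (2 - q) * M ^ (q - 1) = M := by
      rw [← Real.rpow_add hM0]
      norm_num
    have h5 : 0 < M ^ (2 - q) := by positivity
    have h6 : M ^ (2 - q) * (c / 4 * M ^ (q - 1)) ≤ M ^ (2 - q) * (D * J) := by
      calc _ = c / 4 * (M ^ (2 - q) * M ^ (q - 1)) := by ring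
        _ = c / 4 * M := by rw [h4]
        _ ≤ _ := h3
        _ = _ := by ring
    have h7 := le_of_mul_le_mul_left h6 h5
    calc M ^ (q - 1) = 4 / c * (c / 4 * M ^ (q - 1)) := by field_simp
      _ ≤ 4 / c * (D * J) := by gcongr
      _ = _ := by ring
  have hw0 := hX.kernelWeight_pos (m := m) hL0 x y
  have hfin : kernelWeight ρ α m L x y * ∫ z, B.indicator (fun z => g z ^ q) z ∂μ ≤
      (A * (1 + K)) ^ m *
        ∫ z, kernelWeight ρ α m L x z * |lowPassKernel φ lam H L z y| ^ q ∂μ := by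
    rw [← integral_const_mul, ← integral_const_mul]
    have hi : Integrable
        (fun z => kernelWeight ρ α m L x z * |lowPassKernel φ lam H L z y| ^ q) μ := by
      have e : (fun z => kernelWeight ρ α m L x z * |lowPassKernel φ lam H L z y| ^ q) =
          fun z => kernelWeight ρ α m L x z * g z ^ q := by
        funext z; rw [lowPassKernel_comm L z y]
      rw [e]
      refine Integrable.of_bound
        ((hX.measurable_kernelWeight m L x).mul (hgmeas.pow_const q)).aestronglyMeasurable
          ((L ^ α + 1) * (C₁ * M) ^ q) (Eventually.of_forall fun z => ?_)
      have hz0 := hg0 z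
      have := hX.kernelWeight_pos (m := m) hL0 x z
      rw [Real.norm_eq_abs, abs_of_nonneg (by positivity)]
      gcongr
      · exact hX.kernelWeight_le hL0 x z
      · exact hgM z
    refine integral_mono (hgqB.const_mul _) (hi.const_mul _) fun z => ?_
    have hz0 := hg0 z
    have hwz := hX.kernelWeight_pos (m := m) hL0 x z
    simp only
    rw [lowPassKernel_comm L z y]
    by_cases hzB : z ∈ B
    · rw [Set.indicator_of_mem hzB, ← mul_assoc]
      refine mul_le_mul_of_nonneg_right ?_ (Real.rpow_nonneg hz0 q)
      refine hX.kernelWeight_le_mul hA1 hA hL0 hK0.le ?_ x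
      have : ρ y z ≤ K / L := hzB
      rw [le_div_iff₀ hL0] at this
      linarith
    · rw [Set.indicator_of_notMem hzB, mul_zero]
      positivity
  calc _ ≤ kernelWeight ρ α m L x y * (4 * D / c * ∫ z, B.indicator (fun z => g z ^ q) z ∂μ) := by
        gcongr
    _ = 4 * D / c * (kernelWeight ρ α m L x y * ∫ z, B.indicator (fun z => g z ^ q) z ∂μ) := by
        ring
    _ ≤ 4 * D / c * ((A * (1 + K)) ^ m *
        ∫ z, kernelWeight ρ α m L x z * |lowPassKernel φ lam H L z y| ^ q ∂μ) := by gcongr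
    _ = _ := by ring

end DiffusionQuantization

/-! ### Marcinkiewicz–Zygmund measures. -/

namespace DiffusionQuantization

theorem one_le_of_mem_dyadic {N : ℕ} (hN : N ∈ dyadic) : (1 : ℝ) ≤ N := by
  obtain ⟨n, rfl⟩ := hN
  push_cast
  exact one_le_pow₀ (by norm_num)

theorem diffPoly_mono {X : Type*} {φ : ℕ → X → ℝ} {lam : ℕ → ℝ} {L L' : ℝ} (h : L ≤ L') :
    diffPoly φ lam L ≤ diffPoly φ lam L' :=
  Submodule.span_mono (Set.image_mono fun _ hk => le_trans hk h)

theorem phi_mem_diffPoly {X : Type*} {φ : ℕ → X → ℝ} {lam : ℕ → ℝ} {L : ℝ} {k : ℕ}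
    (h : lam k ≤ L) : φ k ∈ diffPoly φ lam L :=
  Submodule.subset_span ⟨k, h, rfl⟩

variable {X : Type*} [TopologicalSpace X] [MeasurableSpace X]
  {ρ : X → X → ℝ} {μ : Measure X} {φ : ℕ → X → ℝ} {lam : ℕ → ℝ} {α : ℝ} {H : ℝ → ℝ}

theorem IsSpectralSystem.sum_mem_diffPoly (h : IsSpectralSystem μ φ lam) (L : ℝ) (c : ℕ → ℝ) :
    (fun y => ∑ k ∈ h.lowFreq L, c k * φ k y) ∈ diffPoly φ lam L := by
  have e : (fun y => ∑ k ∈ h.lowFreq L, c k * φ k y) = ∑ k ∈ h.lowFreq L, c k • φ k := by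
    funext y; simp
  rw [e]
  exact Submodule.sum_mem _ fun k hk =>
    Submodule.smul_mem _ _ (phi_mem_diffPoly (h.mem_lowFreq.1 hk))

theorem IsSpectralSystem.lowPassKernel_mem_diffPoly (h : IsSpectralSystem μ φ lam)
    (hH : IsLowPass H) {L : ℝ} (hL : 0 < L) (x : X) :
    lowPassKernel φ lam H L x ∈ diffPoly φ lam L := by
  rw [show lowPassKernel φ lam H L x = fun y => ∑ k ∈ h.lowFreq L, H (lam k / L) * φ k x * φ k y
    from funext fun y => h.lowPassKernel_eq_sum hH hL x y]
  exact h.sum_mem_diffPoly L _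

theorem IsSpectralSystem.one_mem_diffPoly (h : IsSpectralSystem μ φ lam) {L : ℝ} (hL : 0 ≤ L) :
    (fun _ => 1) ∈ diffPoly φ lam L := by
  have : φ 0 = fun _ => 1 := funext h.phi_zero
  rw [← this]
  exact phi_mem_diffPoly (by rw [h.lam_zero]; exact hL)

omit [TopologicalSpace X] in
theorem lintegral_rpow_le_of_eLpNorm_le {ν μ : Measure X} {q : ℝ≥0∞} (hq : 1 ≤ q) (hq' : q ≠ ⊤)
    {B : ℝ} {f : X → ℝ} (h : eLpNorm f q ν ≤ ENNReal.ofReal B * eLpNorm f q μ) :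
    ∫⁻ x, ENNReal.ofReal (|f x| ^ q.toReal) ∂ν ≤
      ENNReal.ofReal B ^ q.toReal * ∫⁻ x, ENNReal.ofReal (|f x| ^ q.toReal) ∂μ := by
  have hq0 : q ≠ 0 := (one_pos.trans_le hq).ne'
  have hqr : 0 < q.toReal := ENNReal.toReal_pos hq0 hq'
  have e : ∀ x, ENNReal.ofReal (|f x| ^ q.toReal) = ‖f x‖ₑ ^ q.toReal := fun x => by
    rw [← ENNReal.ofReal_rpow_of_nonneg (abs_nonneg _) hqr.le, Real.enorm_eq_ofReal_abs]
  simp_rw [e]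
  rw [eLpNorm_eq_lintegral_rpow_enorm_toReal hq0 hq', eLpNorm_eq_lintegral_rpow_enorm_toReal hq0 hq'] at h
  have h1 := ENNReal.rpow_le_rpow h hqr.le
  rwa [ENNReal.mul_rpow_of_nonneg _ _ hqr.le, ← ENNReal.rpow_mul, ← ENNReal.rpow_mul,
    one_div_mul_cancel hqr.ne', ENNReal.rpow_one, ENNReal.rpow_one] at h1

/-- The inequality tested on the constant `1`, which is a diffusion polynomial since `φ₀ = 1`. -/
theorem IsSpectralSystem.variation_univ_le [IsProbabilityMeasure μ] (h : IsSpectralSystem μ φ lam)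
    {q : ℝ≥0∞} (hq : 1 ≤ q) (hq' : q ≠ ⊤) {B L : ℝ} (hL : 0 ≤ L) {ν : SignedMeasure X}
    (hν : ∀ f ∈ diffPoly φ lam L, eLpNorm f q ν.variation ≤ ENNReal.ofReal B * eLpNorm f q μ) :
    ν.variation Set.univ ≤ ENNReal.ofReal B ^ q.toReal := by
  simpa using lintegral_rpow_le_of_eLpNorm_le hq hq' (hν _ (h.one_mem_diffPoly hL))

variable [BorelSpace X] [IsProbabilityMeasure μ]

set_option maxHeartbeats 800000 in
/-- Uniform families of Marcinkiewicz-Zygmund measures integrate the weights boundedly. -/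
theorem IsDiffusionMeasureSpace.exists_lintegral_kernelWeight_le
    (hX : IsDiffusionMeasureSpace ρ μ φ lam α) (hH : IsLowPass H) {m : ℕ} (hm : α + 1 ≤ m)
    {a : ℝ} (ha : 0 < a) {q : ℝ≥0∞} (hq : 1 ≤ q) (hq' : q ≠ ⊤) {ν : ℕ → SignedMeasure X}
    (hν : IsUniformMZ μ φ lam a q ν) :
    ∃ C > 0, ∀ N ∈ dyadic, IsFiniteMeasure (ν N).variation ∧ ∀ x,
      ∫⁻ y, ENNReal.ofReal (kernelWeight ρ α m N x y) ∂(ν N).variation ≤ ENNReal.ofReal C := by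
  obtain ⟨A, hA, B, hB⟩ := hν
  have hα := hX.alpha_pos
  have hqr : 1 ≤ q.toReal := by
    rw [← ENNReal.toReal_one]; exact ENNReal.toReal_mono hq' hq
  obtain ⟨C₁, hC₁, L₁, hL₁, hrep⟩ := hX.exists_kernelWeight_mul_le hH hm hqr
  obtain ⟨C₂, hC₂, hkerM⟩ := hX.exists_abs_lowPassKernel_le_rpow hH
  obtain ⟨C₃, hC₃, hkerI⟩ := hX.exists_integral_abs_lowPassKernel_le hH
  obtain ⟨C₄, hC₄, hwI⟩ := hX.exists_integral_kernelWeight_le hm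
  set r := q.toReal with hr
  set B' := (max B 0) ^ r with hB'
  have hB'0 : 0 ≤ B' := by positivity
  have hBB' : ENNReal.ofReal B ^ r = ENNReal.ofReal B' := by
    rw [hB', ← ENNReal.ofReal_rpow_of_nonneg (le_max_right _ _) (by linarith)]
    congr 1
    rw [ENNReal.ofReal_max, ENNReal.ofReal_zero, max_eq_left zero_le]
  -- Degree `L = κ N` keeps `Φ_L(z,·)` inside `Π_{aN}`, where the MZ inequality applies. Bounded
  -- degrees `L < L₁` need only the total mass of `|ν_N|`.
  set κ := min a 1 with hκ
  have hκ0 : 0 < κ := lt_min ha one_pos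
  have hmass : ∀ N ∈ dyadic, (ν N).variation Set.univ ≤ ENNReal.ofReal B' := by
    intro N hN
    rw [← hBB']
    have := one_le_of_mem_dyadic hN
    exact hX.spectral.variation_univ_le hq hq' (L := a * N) (by positivity) fun f hf => (hB N hN f hf).2
  refine ⟨((L₁ / κ) ^ α + 1) * B' + (κ ^ α)⁻¹ * (C₁ * C₄ * B' * (C₂ ^ (r - 1) * C₃)) + 1, by positivity,
    fun N hN => ?_⟩
  have hfin : IsFiniteMeasure (ν N).variation := ⟨(hmass N hN).trans_lt ENNReal.ofReal_lt_top⟩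
  refine ⟨hfin, fun x => ?_⟩
  have hN1 := one_le_of_mem_dyadic hN
  have hN0 : (0 : ℝ) < N := by linarith
  set L := κ * N with hL
  have hL0 : 0 < L := by positivity
  rcases lt_or_ge L L₁ with hlt | hge
  · have hw : ∀ y, kernelWeight ρ α m N x y ≤ (L₁ / κ) ^ α + 1 := fun y => by
      refine (hX.kernelWeight_le hN0 x y).trans ?_
      gcongr
      rw [le_div_iff₀ hκ0]
      linarith
    calc _ ≤ ∫⁻ _, ENNReal.ofReal ((L₁ / κ) ^ α + 1) ∂(ν N).variation :=
          lintegral_mono fun y => ENNReal.ofReal_le_ofReal (hw y)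
      _ = ENNReal.ofReal ((L₁ / κ) ^ α + 1) * (ν N).variation Set.univ := lintegral_const _
      _ ≤ ENNReal.ofReal ((L₁ / κ) ^ α + 1) * ENNReal.ofReal B' := by gcongr; exact hmass N hN
      _ = ENNReal.ofReal (((L₁ / κ) ^ α + 1) * B') := (ENNReal.ofReal_mul (by positivity)).symm
      _ ≤ _ := by
          apply ENNReal.ofReal_le_ofReal
          have : 0 ≤ (κ ^ α)⁻¹ * (C₁ * C₄ * B' * (C₂ ^ (r - 1) * C₃)) := by positivity
          linarith
  · have hL1 : 1 ≤ L := hL₁.le.trans hge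
    have hLN : L ≤ N := by
      have : κ ≤ 1 := min_le_right _ _
      nlinarith
    have hLa : L ≤ a * N := by
      have : κ ≤ a := min_le_left _ _
      rw [hL]; gcongr
    set M := L ^ α with hM
    have hM0 : 0 < M := by positivity
    set w := kernelWeight ρ α m L x with hwdef
    have hw0 : ∀ y, 0 < w y := hX.kernelWeight_pos hL0 x
    have hwm : Measurable w := hX.measurable_kernelWeight m L x
    set g : X → X → ℝ := fun z y => |lowPassKernel φ lam H L z y| ^ r with hg
    have hg0 : ∀ z y, 0 ≤ g z y := fun z y => by positivity
    have hgm : Measurable (Function.uncurry g) := by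
      have hφ : ∀ k, Measurable (φ k) := fun k => (hX.spectral.continuous k).measurable
      have e : Function.uncurry g = fun p : X × X =>
          |∑ k ∈ hX.spectral.lowFreq L, H (lam k / L) * φ k p.1 * φ k p.2| ^ r := by
        funext p
        simp only [hg, Function.uncurry, hX.spectral.lowPassKernel_eq_sum hH hL0]
      rw [e]
      have h1 : ∀ k, Measurable fun p : X × X => φ k p.1 := fun k => (hφ k).comp measurable_fst
      have h2 : ∀ k, Measurable fun p : X × X => φ k p.2 := fun k => (hφ k).comp measurable_snd
      refine Measurable.pow_const (Measurable.abs ?_) r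
      exact Finset.measurable_sum _ fun k _ => ((h1 k).const_mul _).mul (h2 k)
    have hgy : ∀ y, Measurable fun z => g z y := fun y => hgm.comp measurable_prodMk_right
    have hgb : ∀ z y, g z y ≤ (C₂ * M) ^ (r - 1) * |lowPassKernel φ lam H L z y| := by
      intro z y
      simp only [hg]
      rcases (abs_nonneg (lowPassKernel φ lam H L z y)).eq_or_lt with h0 | h0
      · rw [← h0, Real.zero_rpow (by linarith)]; simp
      · calc _ = |lowPassKernel φ lam H L z y| ^ (r - 1) * |lowPassKernel φ lam H L z y| := by
              rw [← Real.rpow_add_one h0.ne']; congr 1; ring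
          _ ≤ _ := by
              refine mul_le_mul_of_nonneg_right ?_ h0.le
              exact Real.rpow_le_rpow h0.le (hkerM L hL1 z y) (by linarith)
    have hgI : ∀ z, ∫⁻ y, ENNReal.ofReal (g z y) ∂(ν N).variation ≤
        ENNReal.ofReal (B' * ((C₂ * M) ^ (r - 1) * C₃)) := by
      intro z
      have h1 := lintegral_rpow_le_of_eLpNorm_le hq hq' (hB N hN _ (diffPoly_mono hLa
        (hX.spectral.lowPassKernel_mem_diffPoly hH hL0 z))).2
      rw [hBB'] at h1
      refine h1.trans ?_
      rw [ENNReal.ofReal_mul hB'0]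
      gcongr
      have hi := (hX.integrable_lowPassKernel hH hL1 z).abs.const_mul ((C₂ * M) ^ (r - 1))
      calc _ ≤ ∫⁻ y, ENNReal.ofReal ((C₂ * M) ^ (r - 1) * |lowPassKernel φ lam H L z y|) ∂μ :=
            lintegral_mono fun y => ENNReal.ofReal_le_ofReal (hgb z y)
        _ = ENNReal.ofReal (∫ y, (C₂ * M) ^ (r - 1) * |lowPassKernel φ lam H L z y| ∂μ) :=
            (ofReal_integral_eq_lintegral_ofReal hi
              (Eventually.of_forall fun y => by simp only [Pi.zero_apply]; positivity)).symm
        _ ≤ _ := by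
            apply ENNReal.ofReal_le_ofReal
            rw [integral_const_mul]
            gcongr
            exact hkerI L hL1 z
    have hptw : ∀ y, ENNReal.ofReal (w y) * ENNReal.ofReal (M ^ (r - 1)) ≤
        ENNReal.ofReal C₁ * ∫⁻ z, ENNReal.ofReal (w z) * ENNReal.ofReal (g z y) ∂μ := by
      intro y
      have hi : Integrable (fun z => w z * g z y) μ := by
        refine Integrable.of_bound (hwm.mul (hgy y)).aestronglyMeasurable
          ((L ^ α + 1) * (C₂ * M) ^ r) (Eventually.of_forall fun z => ?_)
        have := hw0 z
        have := hg0 z y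
        rw [Real.norm_eq_abs, abs_of_nonneg (by positivity)]
        refine mul_le_mul (hX.kernelWeight_le hL0 x z) ?_ (hg0 z y) (by positivity)
        exact Real.rpow_le_rpow (abs_nonneg _) (hkerM L hL1 z y) (by linarith)
      have h1 := hrep L hge x y
      have e : ∫⁻ z, ENNReal.ofReal (w z) * ENNReal.ofReal (g z y) ∂μ =
          ENNReal.ofReal (∫ z, w z * g z y ∂μ) := by
        rw [ofReal_integral_eq_lintegral_ofReal hi
          (Eventually.of_forall fun z => mul_nonneg (hw0 z).le (hg0 z y))]
        exact lintegral_congr fun z => (ENNReal.ofReal_mul (hw0 z).le).symm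
      rw [e, ← ENNReal.ofReal_mul (hw0 y).le, ← ENNReal.ofReal_mul hC₁.le]
      exact ENNReal.ofReal_le_ofReal h1
    have hwμ : ∫⁻ z, ENNReal.ofReal (w z) ∂μ ≤ ENNReal.ofReal C₄ := by
      rw [← ofReal_integral_eq_lintegral_ofReal (hX.integrable_kernelWeight m hL0 x)
        (Eventually.of_forall fun z => (hw0 z).le)]
      exact ENNReal.ofReal_le_ofReal (hwI L hL0 x)
    -- Fubini lets the MZ inequality act in `y` for each fixed `z`. Both sides carry `M ^ (r - 1)`:
    -- on the left from the reproduction of the weight, on the right from `|Φ_L| ^ r ≤ (C₂ M) ^ (r -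
    -- 1) |Φ_L|`.
    have hwν : (∫⁻ y, ENNReal.ofReal (w y) ∂(ν N).variation) * ENNReal.ofReal (M ^ (r - 1)) ≤
        ENNReal.ofReal (C₁ * C₄ * B' * (C₂ ^ (r - 1) * C₃)) * ENNReal.ofReal (M ^ (r - 1)) := by
      calc _ = ∫⁻ y, ENNReal.ofReal (w y) * ENNReal.ofReal (M ^ (r - 1)) ∂(ν N).variation :=
            (lintegral_mul_const _ hwm.ennreal_ofReal).symm
        _ ≤ ∫⁻ y, ENNReal.ofReal C₁ *
              ∫⁻ z, ENNReal.ofReal (w z) * ENNReal.ofReal (g z y) ∂μ ∂(ν N).variation :=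
            lintegral_mono hptw
        _ = ENNReal.ofReal C₁ * ∫⁻ y,
              ∫⁻ z, ENNReal.ofReal (w z) * ENNReal.ofReal (g z y) ∂μ ∂(ν N).variation :=
            lintegral_const_mul' _ _ ENNReal.ofReal_ne_top
        _ = ENNReal.ofReal C₁ * ∫⁻ z,
              ∫⁻ y, ENNReal.ofReal (w z) * ENNReal.ofReal (g z y) ∂(ν N).variation ∂μ := by
            congr 1
            refine lintegral_lintegral_swap (Measurable.aemeasurable ?_)
            exact (hwm.comp measurable_snd).ennreal_ofReal.mul
              (hgm.comp measurable_swap).ennreal_ofReal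
        _ = ENNReal.ofReal C₁ * ∫⁻ z, ENNReal.ofReal (w z) *
              ∫⁻ y, ENNReal.ofReal (g z y) ∂(ν N).variation ∂μ := by
            congr 1
            exact lintegral_congr fun z => lintegral_const_mul' _ _ ENNReal.ofReal_ne_top
        _ ≤ ENNReal.ofReal C₁ * ∫⁻ z, ENNReal.ofReal (w z) *
              ENNReal.ofReal (B' * ((C₂ * M) ^ (r - 1) * C₃)) ∂μ := by
            gcongr with z; exact hgI z
        _ = ENNReal.ofReal C₁ * ((∫⁻ z, ENNReal.ofReal (w z) ∂μ) *
              ENNReal.ofReal (B' * ((C₂ * M) ^ (r - 1) * C₃))) := by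
            rw [lintegral_mul_const _ hwm.ennreal_ofReal]
        _ ≤ ENNReal.ofReal C₁ * (ENNReal.ofReal C₄ *
              ENNReal.ofReal (B' * ((C₂ * M) ^ (r - 1) * C₃))) := by gcongr
        _ = _ := by
            rw [← ENNReal.ofReal_mul hC₄.le, ← ENNReal.ofReal_mul hC₁.le,
              ← ENNReal.ofReal_mul (by positivity), Real.mul_rpow hC₂.le hM0.le]
            congr 1; ring
    have hMr : 0 < M ^ (r - 1) := by positivity
    have hwν' := (ENNReal.mul_le_mul_iff_left (by simpa using hMr) ENNReal.ofReal_ne_top).1 hwν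
    have hcomp : ∀ y, kernelWeight ρ α m N x y ≤ (κ ^ α)⁻¹ * w y := by
      intro y
      have hρ := hX.quasiMetric.nonneg x y
      have hκα : 1 ≤ (κ ^ α)⁻¹ :=
        (one_le_inv₀ (by positivity)).2 (Real.rpow_le_one hκ0.le (min_le_right _ _) hα.le)
      have e : (N : ℝ) ^ α = (κ ^ α)⁻¹ * L ^ α := by
        rw [hL, Real.mul_rpow hκ0.le hN0.le]; field_simp
      simp only [hwdef, kernelWeight]
      rw [mul_add, mul_one, e, mul_div_assoc]
      gcongr
    calc _ ≤ ∫⁻ y, ENNReal.ofReal (κ ^ α)⁻¹ * ENNReal.ofReal (w y) ∂(ν N).variation := by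
          refine lintegral_mono fun y => ?_
          rw [← ENNReal.ofReal_mul (by positivity)]
          exact ENNReal.ofReal_le_ofReal (hcomp y)
      _ = ENNReal.ofReal (κ ^ α)⁻¹ * ∫⁻ y, ENNReal.ofReal (w y) ∂(ν N).variation :=
          lintegral_const_mul' _ _ ENNReal.ofReal_ne_top
      _ ≤ ENNReal.ofReal (κ ^ α)⁻¹ * ENNReal.ofReal (C₁ * C₄ * B' * (C₂ ^ (r - 1) * C₃)) := by
          gcongr
      _ = ENNReal.ofReal ((κ ^ α)⁻¹ * (C₁ * C₄ * B' * (C₂ ^ (r - 1) * C₃))) :=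
          (ENNReal.ofReal_mul (by positivity)).symm
      _ ≤ _ := by
          apply ENNReal.ofReal_le_ofReal
          have : 0 ≤ ((L₁ / κ) ^ α + 1) * B' := by positivity
          linarith

end DiffusionQuantization

/-! ### Schur's test, signed integrals and reproduction of polynomials. -/

namespace DiffusionQuantization

/-- Schur's test for symmetric kernels. -/
theorem eLpNorm_integral_mul_le {X : Type*} [MeasurableSpace X] {μ : Measure X} [SFinite μ]
    {K : X → X → ℝ} (hK : Measurable (Function.uncurry K)) (hsymm : ∀ x y, K x y = K y x)
    {C : ℝ≥0∞} (hC : ∀ x, ∫⁻ y, ‖K x y‖ₑ ∂μ ≤ C) {p : ℝ≥0∞} (hp : 1 ≤ p) {f : X → ℝ}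
    (hf : AEStronglyMeasurable f μ) :
    eLpNorm (fun x => ∫ y, f y * K x y ∂μ) p μ ≤ C * eLpNorm f p μ := by
  have hKx : ∀ x, Measurable fun y => ‖K x y‖ₑ := fun x =>
    (hK.comp measurable_prodMk_left).enorm
  have hpt : ∀ x, ‖∫ y, f y * K x y ∂μ‖ₑ ≤ ∫⁻ y, ‖f y‖ₑ * ‖K x y‖ₑ ∂μ := fun x =>
    (enorm_integral_le_lintegral_enorm _).trans_eq (lintegral_congr fun y => enorm_mul _ _)
  rcases eq_or_ne p ⊤ with rfl | hp'
  · rw [eLpNorm_exponent_top]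
    refine eLpNormEssSup_le_of_ae_enorm_bound (Eventually.of_forall fun x => (hpt x).trans ?_)
    calc _ ≤ ∫⁻ y, eLpNorm f ⊤ μ * ‖K x y‖ₑ ∂μ := by
          refine lintegral_mono_ae ?_
          filter_upwards [ae_le_eLpNormEssSup (f := f) (μ := μ)] with y hy
          rw [eLpNorm_exponent_top]
          gcongr
      _ = eLpNorm f ⊤ μ * ∫⁻ y, ‖K x y‖ₑ ∂μ := lintegral_const_mul _ (hKx x)
      _ ≤ eLpNorm f ⊤ μ * C := by gcongr; exact hC x
      _ = _ := mul_comm _ _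
  · have hp0 : p ≠ 0 := (one_pos.trans_le hp).ne'
    set r := p.toReal with hr
    have hr1 : 1 ≤ r := by
      rw [← ENNReal.toReal_one]; exact ENNReal.toReal_mono hp' hp
    have hr0 : 0 < r := by linarith
    have hfm : AEMeasurable (fun y => ‖f y‖ₑ) μ := hf.enorm
    have hpw : ∀ x, ‖∫ y, f y * K x y ∂μ‖ₑ ^ r ≤
        C ^ (r - 1) * ∫⁻ y, ‖f y‖ₑ ^ r * ‖K x y‖ₑ ∂μ := by
      intro x
      -- Hölder's inequality for the measure `|K(x,·)| dμ`, of mass at most `C`, compares its `L₁`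
      -- and `L_p` norms of `f`.
      set ν := μ.withDensity fun y => ‖K x y‖ₑ with hν
      have hνμ : ν ≪ μ := withDensity_absolutelyContinuous _ _
      have h1 := eLpNorm_le_eLpNorm_mul_rpow_measure_univ (p := 1) (q := p) hp
        (hf.mono_ac hνμ)
      have hdens : ∀ {g : X → ℝ≥0∞}, AEMeasurable g μ →
          ∫⁻ y, g y ∂ν = ∫⁻ y, g y * ‖K x y‖ₑ ∂μ := fun {g} hg => by
        rw [hν, lintegral_withDensity_eq_lintegral_mul₀ (hKx x).aemeasurable hg]
        exact lintegral_congr fun y => mul_comm _ _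
      have huniv : ν Set.univ ≤ C := by
        rw [hν, withDensity_apply _ MeasurableSet.univ, setLIntegral_univ]
        exact hC x
      rw [eLpNorm_one_eq_lintegral_enorm, eLpNorm_eq_lintegral_rpow_enorm_toReal hp0 hp',
        hdens hfm, hdens (hfm.pow_const r), ← hr, ENNReal.toReal_one] at h1
      have h2 := ENNReal.rpow_le_rpow ((hpt x).trans h1) hr0.le
      rw [ENNReal.mul_rpow_of_nonneg _ _ hr0.le, ← ENNReal.rpow_mul, ← ENNReal.rpow_mul,
        one_div_mul_cancel hr0.ne', ENNReal.rpow_one] at h2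
      refine h2.trans ?_
      rw [mul_comm]
      gcongr ?_ * _
      have e : (1 / 1 - 1 / r) * r = r - 1 := by field_simp
      rw [e]
      exact ENNReal.rpow_le_rpow huniv (by linarith)
    have hK2 : Measurable (Function.uncurry fun x y => ‖K x y‖ₑ) := hK.enorm
    rw [eLpNorm_eq_lintegral_rpow_enorm_toReal hp0 hp', eLpNorm_eq_lintegral_rpow_enorm_toReal hp0 hp',
      ← hr]
    have hI : ∫⁻ x, ‖∫ y, f y * K x y ∂μ‖ₑ ^ r ∂μ ≤ C ^ r * ∫⁻ y, ‖f y‖ₑ ^ r ∂μ := by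
      have hm : AEMeasurable (Function.uncurry fun x y => ‖f y‖ₑ ^ r * ‖K x y‖ₑ) (μ.prod μ) := by
        refine AEMeasurable.mul ?_ hK2.aemeasurable
        exact (hfm.pow_const r).comp_quasiMeasurePreserving Measure.quasiMeasurePreserving_snd
      calc _ ≤ ∫⁻ x, C ^ (r - 1) * ∫⁻ y, ‖f y‖ₑ ^ r * ‖K x y‖ₑ ∂μ ∂μ := lintegral_mono hpw
        _ = C ^ (r - 1) * ∫⁻ x, ∫⁻ y, ‖f y‖ₑ ^ r * ‖K x y‖ₑ ∂μ ∂μ :=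
            lintegral_const_mul'' _ hm.lintegral_prod_right'
        _ = C ^ (r - 1) * ∫⁻ y, ∫⁻ x, ‖f y‖ₑ ^ r * ‖K x y‖ₑ ∂μ ∂μ := by
            rw [lintegral_lintegral_swap hm]
        _ ≤ C ^ (r - 1) * ∫⁻ y, ‖f y‖ₑ ^ r * C ∂μ := by
            gcongr with y
            rw [lintegral_const_mul]
            · gcongr
              simp_rw [hsymm _ y]
              exact hC y
            · simp_rw [hsymm _ y]
              exact hKx y
        _ = C ^ (r - 1) * ((∫⁻ y, ‖f y‖ₑ ^ r ∂μ) * C) := by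
            rw [lintegral_mul_const'' _ (hfm.pow_const r)]
        _ = C ^ (r - 1) * C ^ (1 : ℝ) * ∫⁻ y, ‖f y‖ₑ ^ r ∂μ := by
            rw [ENNReal.rpow_one]; ring
        _ = _ := by
            rw [← ENNReal.rpow_add_of_nonneg _ _ (by linarith) zero_le_one, sub_add_cancel]
    calc _ ≤ (C ^ r * ∫⁻ y, ‖f y‖ₑ ^ r ∂μ) ^ (1 / r) := ENNReal.rpow_le_rpow hI (by positivity)
      _ = _ := by
          rw [ENNReal.mul_rpow_of_nonneg _ _ (by positivity), ← ENNReal.rpow_mul,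
            mul_one_div_cancel hr0.ne', ENNReal.rpow_one]

theorem enorm_signedIntegral_le {X : Type*} [MeasurableSpace X] (ν : SignedMeasure X) (f : X → ℝ) :
    ‖∫ᵛ x, f x ∂<•ν‖ₑ ≤ ∫⁻ x, ‖f x‖ₑ ∂ν.variation := by
  refine VectorMeasure.enorm_integral_le_lintegral_enorm.trans ?_
  refine mul_le_of_le_one_left (by positivity) ?_
  rw [enorm_eq_nnnorm]
  have : ‖(ContinuousLinearMap.lsmul ℝ ℝ : ℝ →L[ℝ] ℝ →L[ℝ] ℝ).flip‖ ≤ 1 := by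
    rw [ContinuousLinearMap.opNorm_flip]
    exact ContinuousLinearMap.opNorm_lsmul_le
  exact_mod_cast this

theorem abs_signedIntegral_mul_le {X : Type*} [MeasurableSpace X] {ν : SignedMeasure X}
    {e g : X → ℝ} {b C : ℝ} (hb : 0 ≤ b) (hC : 0 ≤ C) (he : ∀ x, |e x| ≤ b)
    (hg : ∫⁻ x, ‖g x‖ₑ ∂ν.variation ≤ ENNReal.ofReal C) :
    |∫ᵛ x, e x * g x ∂<•ν| ≤ b * C := by
  have h : ‖∫ᵛ x, e x * g x ∂<•ν‖ₑ ≤ ENNReal.ofReal (b * C) := by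
    refine (enorm_signedIntegral_le ν _).trans ?_
    rw [ENNReal.ofReal_mul hb]
    calc _ ≤ ∫⁻ x, ENNReal.ofReal b * ‖g x‖ₑ ∂ν.variation := by
          refine lintegral_mono fun x => ?_
          rw [enorm_mul, Real.enorm_eq_ofReal_abs]
          gcongr
          exact he x
      _ = ENNReal.ofReal b * ∫⁻ x, ‖g x‖ₑ ∂ν.variation :=
          lintegral_const_mul' _ _ ENNReal.ofReal_ne_top
      _ ≤ _ := by gcongr
  rw [Real.enorm_eq_ofReal_abs] at h
  exact (ENNReal.ofReal_le_ofReal_iff (by positivity)).1 h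

theorem signedIntegral_sum_mul {X : Type*} [MeasurableSpace X] {ν : SignedMeasure X} {ι : Type*}
    (s : Finset ι) {f : ι → X → ℝ} (c : ι → ℝ) (hf : ∀ i ∈ s, Integrable (f i) ν.variation) :
    ∫ᵛ x, ∑ i ∈ s, c i * f i x ∂<•ν = ∑ i ∈ s, c i * ∫ᵛ x, f i x ∂<•ν := by
  rw [VectorMeasure.integral_finsetSum s fun i hi => (hf i hi).const_mul (c i)]
  exact Finset.sum_congr rfl fun i _ => VectorMeasure.integral_fun_smul ν _ (c i) (f i)

theorem isQuadrature_toSignedMeasure {X : Type*} [MeasurableSpace X] {μ : Measure X}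
    [IsFiniteMeasure μ] {φ : ℕ → X → ℝ} {lam : ℕ → ℝ} {a N : ℝ} :
    IsQuadrature μ φ lam a N μ.toSignedMeasure := fun f _ => by simp

variable {X : Type*} [TopologicalSpace X] [MeasurableSpace X]
  {ρ : X → X → ℝ} {μ : Measure X} {φ : ℕ → X → ℝ} {lam : ℕ → ℝ} {α : ℝ} {H : ℝ → ℝ}

theorem IsSpectralSystem.sigma_eq_sum (h : IsSpectralSystem μ φ lam) (hH : IsLowPass H) {N : ℝ}
    (hN : 0 < N) (f : X → ℝ) (ν : SignedMeasure X) (x : X) :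
    sigma φ lam H N f ν x =
      ∑ k ∈ h.lowFreq N, H (lam k / N) * (∫ᵛ y, f y * φ k y ∂<•ν) * φ k x :=
  h.tsum_filter hH hN _ _

theorem IsSpectralSystem.sigma_eq_integral (h : IsSpectralSystem μ φ lam) (hH : IsLowPass H)
    {N : ℝ} (hN : 0 < N) {f : X → ℝ} {ν : SignedMeasure X}
    (hf : ∀ k, Integrable (fun y => f y * φ k y) ν.variation) (x : X) :
    sigma φ lam H N f ν x = ∫ᵛ y, f y * lowPassKernel φ lam H N x y ∂<•ν := by
  have e : (fun y => f y * lowPassKernel φ lam H N x y) =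
      fun y => ∑ k ∈ h.lowFreq N, H (lam k / N) * φ k x * (f y * φ k y) := by
    funext y
    rw [h.lowPassKernel_eq_sum hH hN, Finset.mul_sum]
    exact Finset.sum_congr rfl fun k _ => by ring
  rw [e, signedIntegral_sum_mul _ _ fun k _ => hf k, h.sigma_eq_sum hH hN]
  exact Finset.sum_congr rfl fun k _ => by ring

theorem IsSpectralSystem.sigma_mem_diffPoly (h : IsSpectralSystem μ φ lam) (hH : IsLowPass H)
    {N : ℝ} (hN : 0 < N) (f : X → ℝ) (ν : SignedMeasure X) :
    sigma φ lam H N f ν ∈ diffPoly φ lam N := by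
  rw [show sigma φ lam H N f ν = _ from funext fun x => h.sigma_eq_sum hH hN f ν x]
  exact h.sum_mem_diffPoly N fun k => H (lam k / N) * ∫ᵛ y, f y * φ k y ∂<•ν

theorem IsSpectralSystem.sigma_sub (h : IsSpectralSystem μ φ lam) (hH : IsLowPass H)
    {N : ℝ} (hN : 0 < N) {f g : X → ℝ} {ν : SignedMeasure X}
    (hf : ∀ k, Integrable (fun y => f y * φ k y) ν.variation)
    (hg : ∀ k, Integrable (fun y => g y * φ k y) ν.variation) :
    sigma φ lam H N (f - g) ν = sigma φ lam H N f ν - sigma φ lam H N g ν := by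
  funext x
  rw [Pi.sub_apply, h.sigma_eq_sum hH hN, h.sigma_eq_sum hH hN, h.sigma_eq_sum hH hN,
    ← Finset.sum_sub_distrib]
  refine Finset.sum_congr rfl fun k _ => ?_
  have : ∫ᵛ y, (f - g) y * φ k y ∂<•ν = ∫ᵛ y, f y * φ k y ∂<•ν - ∫ᵛ y, g y * φ k y ∂<•ν := by
    rw [← VectorMeasure.integral_fun_sub (hf k) (hg k)]
    congr 1; funext y; simp [sub_mul]
  rw [this]; ring

theorem IsSpectralSystem.continuous_of_mem_diffPoly (h : IsSpectralSystem μ φ lam) {L : ℝ}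
    {f : X → ℝ} (hf : f ∈ diffPoly φ lam L) : Continuous f := by
  induction hf using Submodule.span_induction with
  | mem x hx => obtain ⟨k, -, rfl⟩ := hx; exact h.continuous k
  | zero => exact continuous_zero
  | add x y _ _ hx hy => exact hx.add hy
  | smul c x _ hx => exact hx.const_smul c

theorem IsDiffusionMeasureSpace.exists_abs_le_of_mem_diffPoly
    (hX : IsDiffusionMeasureSpace ρ μ φ lam α) {L : ℝ} {f : X → ℝ} (hf : f ∈ diffPoly φ lam L) :
    ∃ C : ℝ, ∀ x, |f x| ≤ C := by
  induction hf using Submodule.span_induction with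
  | mem x hx => obtain ⟨k, -, rfl⟩ := hx; exact hX.exists_abs_phi_le k
  | zero => exact ⟨0, by simp⟩
  | add x y _ _ hx hy =>
    obtain ⟨C, hC⟩ := hx
    obtain ⟨D, hD⟩ := hy
    exact ⟨C + D, fun z => (abs_add_le _ _).trans (add_le_add (hC z) (hD z))⟩
  | smul c x _ hx =>
    obtain ⟨C, hC⟩ := hx
    refine ⟨|c| * C, fun z => ?_⟩
    rw [Pi.smul_apply, smul_eq_mul, abs_mul]
    exact mul_le_mul_of_nonneg_left (hC z) (abs_nonneg c)

/-- Diffusion polynomials of degree `M / 2` are reproduced by `σ_M`. -/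
theorem IsSpectralSystem.sigma_eq_self (h : IsSpectralSystem μ φ lam) (hH : IsLowPass H)
    {a : ℝ} (hprod : StrongProduct φ lam a) {M : ℕ} (hM : M ∈ dyadic) {ν : SignedMeasure X}
    (hν : IsQuadrature μ φ lam a M ν) {f : X → ℝ} (hf : f ∈ diffPoly φ lam (M / 2)) :
    sigma φ lam H M f ν = f := by
  have hM0 : (0 : ℝ) < M := one_pos.trans_le (one_le_of_mem_dyadic hM)
  -- Both factors lie in `Π_M`, so their product lies in `Π_{aM}`, where `ν` is exact. The
  -- coefficients of `f` are therefore the true ones, and `H = 1` up to frequency `M / 2`.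
  have hquad : ∀ k ∈ h.lowFreq M, ∫ y, f y * φ k y ∂μ = ∫ᵛ y, f y * φ k y ∂<•ν := fun k hk =>
    hν _ (hprod M hM f (diffPoly_mono (by linarith) hf) _
      (phi_mem_diffPoly (h.mem_lowFreq.1 hk)))
  -- Integrability is carried along in the induction because splitting the integral of a sum
  -- requires it.
  have key : ∀ x, ∑ k ∈ h.lowFreq M, H (lam k / M) * (∫ y, f y * φ k y ∂μ) * φ k x = f x ∧
      ∀ k, Integrable (fun y => f y * φ k y) μ := by
    clear hquad
    intro x
    induction hf using Submodule.span_induction with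
    | mem g hg =>
      obtain ⟨j, hj, rfl⟩ := hg
      refine ⟨?_, fun k => (h.memLp j).integrable_mul (h.memLp k)⟩
      have hj' : lam j ≤ M / 2 := hj
      have hjM : j ∈ h.lowFreq M := h.mem_lowFreq.2 (by linarith)
      have h1 : H (lam j / M) = 1 := hH.eq_one _ (div_nonneg (h.lam_nonneg j) hM0.le) (by
        rw [div_le_iff₀ hM0]; linarith)
      simp_rw [h.integral_phi_mul]
      simp [hjM, h1]
    | zero => simp
    | add g₁ g₂ _ _ h₁ h₂ =>
      refine ⟨?_, fun k => by
        simp_rw [Pi.add_apply, add_mul]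
        exact (h₁.2 k).add (h₂.2 k)⟩
      rw [Pi.add_apply, ← h₁.1, ← h₂.1, ← Finset.sum_add_distrib]
      refine Finset.sum_congr rfl fun k _ => ?_
      simp_rw [Pi.add_apply, add_mul]
      rw [integral_add (h₁.2 k) (h₂.2 k)]
      ring
    | smul c g _ hg =>
      refine ⟨?_, fun k => by simpa [mul_assoc] using (hg.2 k).const_mul c⟩
      rw [Pi.smul_apply, ← hg.1, Finset.smul_sum]
      refine Finset.sum_congr rfl fun k _ => ?_
      simp_rw [Pi.smul_apply, smul_eq_mul, mul_assoc]
      rw [integral_const_mul]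
      ring
  funext x
  rw [h.sigma_eq_sum hH hM0, ← (key x).1]
  refine Finset.sum_congr rfl fun k hk => ?_
  rw [hquad k hk]

end DiffusionQuantization

/-! ### Stability, approximation and the quantization error. -/

namespace DiffusionQuantization

theorem two_mul_mem_dyadic {N : ℕ} (hN : N ∈ dyadic) : 2 * N ∈ dyadic := by
  obtain ⟨n, rfl⟩ := hN
  exact ⟨n + 1, by simp only; rw [pow_succ, mul_comm]⟩

theorem eq_one_or_eq_two_mul_of_mem_dyadic {N : ℕ} (hN : N ∈ dyadic) :
    N = 1 ∨ ∃ N' ∈ dyadic, N = 2 * N' := by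
  obtain ⟨n, rfl⟩ := hN
  cases n with
  | zero => exact Or.inl rfl
  | succ n => exact Or.inr ⟨2 ^ n, ⟨n, rfl⟩, by simp only; rw [pow_succ, mul_comm]⟩

/-- For a measure of full support the essential supremum of a continuous function bounds it at every
point, hence also where the measures `μ_N` charge null sets of `μ`. -/
theorem abs_le_of_continuous {X : Type*} [TopologicalSpace X] [MeasurableSpace X] {μ : Measure X}
    [μ.IsOpenPosMeasure] {f : X → ℝ} (hf : Continuous f) (hfm : MemLp f ⊤ μ) (x : X) :
    |f x| ≤ (eLpNorm f ⊤ μ).toReal := by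
  have hU : IsOpen {y | (eLpNorm f ⊤ μ).toReal < |f y|} := isOpen_lt continuous_const hf.abs
  have h0 : μ {y | (eLpNorm f ⊤ μ).toReal < |f y|} = 0 := by
    have := ae_le_eLpNormEssSup (f := f) (μ := μ)
    rw [ae_iff] at this
    refine measure_mono_null (fun y hy => ?_) this
    intro hle
    rw [← eLpNorm_exponent_top, Real.enorm_eq_ofReal_abs,
      ENNReal.ofReal_le_iff_le_toReal hfm.eLpNorm_ne_top] at hle
    exact absurd hy (not_lt.2 hle)
  have := hU.eq_empty_of_measure_zero h0
  by_contra hx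
  have hx' : x ∈ {y | (eLpNorm f ⊤ μ).toReal < |f y|} := not_le.1 hx
  rw [this] at hx'
  exact hx'

variable {X : Type*} [TopologicalSpace X] [MeasurableSpace X] [BorelSpace X]
  {ρ : X → X → ℝ} {μ : Measure X} {φ : ℕ → X → ℝ} {lam : ℕ → ℝ} {α : ℝ} {H : ℝ → ℝ}

theorem IsDiffusionMeasureSpace.integrable_mul_phi (hX : IsDiffusionMeasureSpace ρ μ φ lam α)
    {ν : Measure X} [IsFiniteMeasure ν] {f : X → ℝ} (hf : Measurable f) {C : ℝ}
    (hC : ∀ x, |f x| ≤ C) (k : ℕ) : Integrable (fun y => f y * φ k y) ν := by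
  obtain ⟨D, hD⟩ := hX.exists_abs_phi_le k
  refine Integrable.of_bound (hf.mul (hX.spectral.continuous k).measurable).aestronglyMeasurable
    (C * D) (Eventually.of_forall fun x => ?_)
  rw [Real.norm_eq_abs, abs_mul]
  exact mul_le_mul (hC x) (hD x) (abs_nonneg _) ((abs_nonneg _).trans (hC x))

theorem IsSpectralSystem.measurable_uncurry_lowPassKernel (h : IsSpectralSystem μ φ lam)
    (hH : IsLowPass H) {L : ℝ} (hL : 0 < L) :
    Measurable (Function.uncurry (lowPassKernel φ lam H L)) := by
  have hφ : ∀ k, Measurable (φ k) := fun k => (h.continuous k).measurable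
  have e : Function.uncurry (lowPassKernel φ lam H L) = fun p : X × X =>
      ∑ k ∈ h.lowFreq L, H (lam k / L) * φ k p.1 * φ k p.2 :=
    funext fun p => h.lowPassKernel_eq_sum hH hL p.1 p.2
  rw [e]
  exact Finset.measurable_sum _ fun k _ =>
    (((hφ k).comp measurable_fst).const_mul _).mul ((hφ k).comp measurable_snd)

omit [BorelSpace X] in
theorem IsSpectralSystem.sigma_const_mul (h : IsSpectralSystem μ φ lam) (hH : IsLowPass H) {N : ℝ}
    (hN : 0 < N) (c : ℝ) (f : X → ℝ) (ν : SignedMeasure X) (x : X) :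
    sigma φ lam H N (fun y => c * f y) ν x = c * sigma φ lam H N f ν x := by
  rw [h.sigma_eq_sum hH hN, h.sigma_eq_sum hH hN, Finset.mul_sum]
  refine Finset.sum_congr rfl fun k _ => ?_
  have : ∫ᵛ y, c * f y * φ k y ∂<•ν = c * ∫ᵛ y, f y * φ k y ∂<•ν := by
    simp_rw [mul_assoc]
    exact VectorMeasure.integral_fun_smul ν _ c fun y => f y * φ k y
  rw [this]; ring

variable [IsProbabilityMeasure μ]

/-- Uniform families of Marcinkiewicz-Zygmund measures integrate the localized kernels boundedly. -/
theorem IsDiffusionMeasureSpace.exists_lintegral_lowPassKernel_le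
    (hX : IsDiffusionMeasureSpace ρ μ φ lam α) (hH : IsLowPass H)
    {a : ℝ} (ha : 0 < a) {q : ℝ≥0∞} (hq : 1 ≤ q) (hq' : q ≠ ⊤) {ν : ℕ → SignedMeasure X}
    (hν : IsUniformMZ μ φ lam a q ν) :
    ∃ C > 0, ∀ N ∈ dyadic, IsFiniteMeasure (ν N).variation ∧ ∀ x,
      ∫⁻ y, ‖lowPassKernel φ lam H N x y‖ₑ ∂(ν N).variation ≤ ENNReal.ofReal C ∧
      ∫⁻ y, ‖lowPassKernel φ lam H (2 * N) x y‖ₑ ∂(ν N).variation ≤ ENNReal.ofReal C := by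
  obtain ⟨m, hm⟩ := exists_nat_ge (α + 1)
  have hα := hX.alpha_pos
  obtain ⟨C₀, hC₀, hker⟩ := hX.exists_abs_lowPassKernel_le hH (m := m) (by linarith)
  obtain ⟨C₁, hC₁, hw⟩ := hX.exists_lintegral_kernelWeight_le hH hm ha hq hq' hν
  have h2 : (1 : ℝ) ≤ 2 ^ α := Real.one_le_rpow (by norm_num) hα.le
  refine ⟨C₀ * 2 ^ α * C₁, by positivity, fun N hN => ⟨(hw N hN).1, fun x => ?_⟩⟩
  have hN1 := one_le_of_mem_dyadic hN
  have hN0 : (0 : ℝ) < N := by linarith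
  have hgen : ∀ K : X → ℝ, (∀ y, |K y| ≤ C₀ * 2 ^ α * kernelWeight ρ α m N x y) →
      ∫⁻ y, ‖K y‖ₑ ∂(ν N).variation ≤ ENNReal.ofReal (C₀ * 2 ^ α * C₁) := by
    intro K hK
    calc _ ≤ ∫⁻ y, ENNReal.ofReal (C₀ * 2 ^ α) *
          ENNReal.ofReal (kernelWeight ρ α m N x y) ∂(ν N).variation := by
          refine lintegral_mono fun y => ?_
          rw [Real.enorm_eq_ofReal_abs, ← ENNReal.ofReal_mul (by positivity)]
          exact ENNReal.ofReal_le_ofReal (hK y)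
      _ = ENNReal.ofReal (C₀ * 2 ^ α) *
          ∫⁻ y, ENNReal.ofReal (kernelWeight ρ α m N x y) ∂(ν N).variation :=
          lintegral_const_mul' _ _ ENNReal.ofReal_ne_top
      _ ≤ ENNReal.ofReal (C₀ * 2 ^ α) * ENNReal.ofReal C₁ := by gcongr; exact (hw N hN).2 x
      _ = _ := (ENNReal.ofReal_mul (by positivity)).symm
  refine ⟨hgen _ fun y => ?_, hgen _ fun y => ?_⟩
  · have hw0 := hX.kernelWeight_pos (m := m) hN0 x y
    refine (hker N hN1 x y).trans ?_
    rw [mul_assoc]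
    gcongr
    exact le_mul_of_one_le_left hw0.le h2
  · refine (hker (2 * N) (by linarith) x y).trans ?_
    rw [mul_assoc]
    gcongr
    have hρ := hX.quasiMetric.nonneg x y
    unfold kernelWeight
    rw [Real.mul_rpow (by norm_num) hN0.le, mul_add, mul_one, mul_div_assoc]
    gcongr
    linarith

/-- Stability of the operators `σ_N`. -/
theorem IsDiffusionMeasureSpace.exists_eLpNorm_sigma_le
    (hX : IsDiffusionMeasureSpace ρ μ φ lam α) (hH : IsLowPass H)
    {a : ℝ} (ha : 0 < a) {q : ℝ≥0∞} (hq : 1 ≤ q) (hq' : q ≠ ⊤) {p : ℝ≥0∞} (hp : 1 ≤ p)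
    {ν : ℕ → SignedMeasure X} (hν_top : p = ∞ → IsUniformMZ μ φ lam a q ν)
    (hν_lt : p ≠ ∞ → ∀ N ∈ dyadic, ν N = μ.toSignedMeasure) :
    ∃ C > 0, ∀ N ∈ dyadic, ∀ f : X → ℝ, MemLp f p μ → (p = ∞ → Continuous f) →
      (∀ k, Integrable (fun y => f y * φ k y) (ν N).variation) ∧
      eLpNorm (sigma φ lam H N f (ν N)) p μ ≤ ENNReal.ofReal C * eLpNorm f p μ ∧
      ∀ x, |sigma φ lam H N f (ν N) x| ≤ C * (N : ℝ) ^ α * (eLpNorm f p μ).toReal := by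
  by_cases hpt : p = ∞
  · obtain ⟨C, hC, hK⟩ := hX.exists_lintegral_lowPassKernel_le hH ha hq hq' (hν_top hpt)
    have := hX.isOpenPosMeasure hH
    refine ⟨C, hC, fun N hN f hf hfc => ?_⟩
    obtain ⟨hfin, hKN⟩ := hK N hN
    have hN1 := one_le_of_mem_dyadic hN
    have hN0 : (0 : ℝ) < N := by linarith
    subst hpt
    have hfb := abs_le_of_continuous (hfc rfl) hf
    have hint := fun k => hX.integrable_mul_phi (ν := (ν N).variation) (hfc rfl).measurable hfb k
    have hpt : ∀ x, |sigma φ lam H N f (ν N) x| ≤ (eLpNorm f ⊤ μ).toReal * C := fun x => by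
      rw [hX.spectral.sigma_eq_integral hH hN0 hint]
      exact abs_signedIntegral_mul_le ENNReal.toReal_nonneg hC.le hfb (hKN x).1
    refine ⟨hint, ?_, fun x => (hpt x).trans ?_⟩
    · rw [eLpNorm_exponent_top]
      refine eLpNormEssSup_le_of_ae_enorm_bound (Eventually.of_forall fun x => ?_)
      rw [Real.enorm_eq_ofReal_abs]
      refine (ENNReal.ofReal_le_ofReal (hpt x)).trans ?_
      rw [ENNReal.ofReal_mul ENNReal.toReal_nonneg, ENNReal.ofReal_toReal hf.eLpNorm_ne_top,
        mul_comm]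
    · have h1 : 1 ≤ (N : ℝ) ^ α := Real.one_le_rpow hN1 hX.alpha_pos.le
      rw [mul_comm]
      gcongr
      exact le_mul_of_one_le_right hC.le h1
  · obtain ⟨C₁, hC₁, hI⟩ := hX.exists_integral_abs_lowPassKernel_le hH
    obtain ⟨C₂, hC₂, hM⟩ := hX.exists_abs_lowPassKernel_le_rpow hH
    refine ⟨C₁ + C₂, by positivity, fun N hN f hf _ => ?_⟩
    have hN1 := one_le_of_mem_dyadic hN
    have hN0 : (0 : ℝ) < N := by linarith
    rw [hν_lt hpt N hN]
    have hfi : Integrable f μ := hf.integrable hp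
    have hint : ∀ k, Integrable (fun y => f y * φ k y) μ.toSignedMeasure.variation := fun k => by
      rw [Measure.variation_toSignedMeasure]
      obtain ⟨D, hD⟩ := hX.exists_abs_phi_le k
      exact hfi.mul_bdd (hX.spectral.continuous k).measurable.aestronglyMeasurable
        (Eventually.of_forall hD)
    have hσ : ∀ x, sigma φ lam H N f μ.toSignedMeasure x =
        ∫ y, f y * lowPassKernel φ lam H N x y ∂μ := fun x => by
      rw [hX.spectral.sigma_eq_integral hH hN0 hint, VectorMeasure.integral_toSignedMeasure]
    refine ⟨hint, ?_, fun x => ?_⟩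
    · rw [show sigma φ lam H N f μ.toSignedMeasure = _ from funext hσ]
      refine (eLpNorm_integral_mul_le (hX.spectral.measurable_uncurry_lowPassKernel hH hN0)
        (fun x y => lowPassKernel_comm _ x y) (C := ENNReal.ofReal (C₁ + C₂)) (fun x => ?_) hp
        hf.aestronglyMeasurable)
      have hi := (hX.integrable_lowPassKernel hH hN1 x).abs
      simp_rw [Real.enorm_eq_ofReal_abs]
      rw [← ofReal_integral_eq_lintegral_ofReal hi (Eventually.of_forall fun y => abs_nonneg _)]
      exact ENNReal.ofReal_le_ofReal ((hI N hN1 x).trans (by linarith))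
    -- For finite `p` point values are bounded through `sup |Φ_N| ≲ N ^ α` and the `L₁` norm. The
    -- loss of `N ^ α` matters only for the size of the quantized integers, whose logarithm is
    -- counted.
    · rw [hσ x]
      have h1 : ∫ y, |f y| ∂μ ≤ (eLpNorm f p μ).toReal := by
        have h2 := eLpNorm_le_eLpNorm_of_exponent_le hp hf.aestronglyMeasurable
        have h3 := ENNReal.toReal_mono hf.eLpNorm_ne_top h2
        rw [eLpNorm_one_eq_lintegral_enorm] at h3
        refine le_trans (le_of_eq ?_) h3
        simp_rw [← Real.norm_eq_abs]
        exact integral_norm_eq_lintegral_enorm hf.aestronglyMeasurable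
      have hNα : 0 < (N : ℝ) ^ α := by positivity
      calc _ ≤ ∫ y, |f y * lowPassKernel φ lam H N x y| ∂μ := abs_integral_le_integral_abs
        _ ≤ ∫ y, C₂ * (N : ℝ) ^ α * |f y| ∂μ := by
            refine integral_mono_of_nonneg (Eventually.of_forall fun y => abs_nonneg _)
              (hfi.abs.const_mul _) (Eventually.of_forall fun y => ?_)
            simp only
            rw [abs_mul, mul_comm]
            gcongr
            exact hM N hN1 x y
        _ = C₂ * (N : ℝ) ^ α * ∫ y, |f y| ∂μ := integral_const_mul _ _
        _ ≤ (C₁ + C₂) * (N : ℝ) ^ α * (eLpNorm f p μ).toReal := by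
            gcongr
            · linarith

theorem IsDiffusionMeasureSpace.memLp_of_mem_diffPoly (hX : IsDiffusionMeasureSpace ρ μ φ lam α)
    {L : ℝ} {f : X → ℝ} (hf : f ∈ diffPoly φ lam L) (p : ℝ≥0∞) : MemLp f p μ := by
  obtain ⟨C, hC⟩ := hX.exists_abs_le_of_mem_diffPoly hf
  exact MemLp.of_bound
    (hX.spectral.continuous_of_mem_diffPoly hf).measurable.aestronglyMeasurable C
    (Eventually.of_forall hC)

/-- Approximation of Sobolev functions by `σ_N`. -/
theorem IsDiffusionMeasureSpace.exists_eLpNorm_sub_sigma_le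
    (hX : IsDiffusionMeasureSpace ρ μ φ lam α) (hH : IsLowPass H)
    {a : ℝ} (ha : 0 < a) (hprod : StrongProduct φ lam a) {q : ℝ≥0∞} (hq : 1 ≤ q) (hq' : q ≠ ⊤)
    {p : ℝ≥0∞} (hp : 1 ≤ p)
    {ν : ℕ → SignedMeasure X} (hν_top : p = ∞ → IsUniformMZ μ φ lam a q ν)
    (hν_lt : p ≠ ∞ → ∀ N ∈ dyadic, ν N = μ.toSignedMeasure)
    (hquad : ∀ N ∈ dyadic, IsQuadrature μ φ lam a N (ν N)) {s : ℝ} (hs : 0 < s) :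
    ∃ C > 0, ∀ r ≥ 0, ∀ N ∈ dyadic, ∀ f ∈ sobolevBall μ φ lam s p r,
      eLpNorm (f - sigma φ lam H N f (ν N)) p μ ≤ ENNReal.ofReal (C * r * (N : ℝ) ^ (-s)) := by
  obtain ⟨C, hC, hstab⟩ := hX.exists_eLpNorm_sigma_le hH ha hq hq' hp hν_top hν_lt
  have h2s : (1 : ℝ) ≤ 2 ^ s := Real.one_le_rpow (by norm_num) hs.le
  -- The factor `2 ^ s` pays for approximation from `Π_{N/2}`, the space reproduced by `σ_N`. For `N
  -- = 1` there is no dyadic half, and `‖f‖_p ≤ r` suffices.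
  refine ⟨(1 + C) * 2 ^ s, by positivity, fun r hr N hN f hf => ?_⟩
  obtain ⟨hfm, hfc, hfr⟩ := hf
  have hN1 := one_le_of_mem_dyadic hN
  have hN0 : (0 : ℝ) < N := by linarith
  have hσm : ∀ g, AEStronglyMeasurable (sigma φ lam H N g (ν N)) μ := fun g =>
    (hX.spectral.continuous_of_mem_diffPoly
      (hX.spectral.sigma_mem_diffPoly hH hN0 g (ν N))).measurable.aestronglyMeasurable
  have hbase : ∀ g : X → ℝ, MemLp g p μ → (p = ∞ → Continuous g) →
      eLpNorm (g - sigma φ lam H N g (ν N)) p μ ≤ ENNReal.ofReal (1 + C) * eLpNorm g p μ := by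
    intro g hg hgc
    refine (eLpNorm_sub_le hg.aestronglyMeasurable (hσm g) hp).trans ?_
    rw [ENNReal.ofReal_add zero_le_one hC.le, ENNReal.ofReal_one, add_mul, one_mul]
    gcongr
    exact (hstab N hN g hg hgc).2.1
  rcases eq_one_or_eq_two_mul_of_mem_dyadic hN with h1 | ⟨N', hN', h2⟩
  · have hfr' : eLpNorm f p μ ≤ ENNReal.ofReal r := le_self_add.trans hfr
    refine (hbase f hfm hfc).trans ?_
    have e : (N : ℝ) ^ (-s) = 1 := by rw [h1]; simp
    rw [e, mul_one]
    calc _ ≤ ENNReal.ofReal (1 + C) * ENNReal.ofReal r := by gcongr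
      _ = ENNReal.ofReal ((1 + C) * r) := (ENNReal.ofReal_mul (by positivity)).symm
      _ ≤ _ := by
        apply ENNReal.ofReal_le_ofReal
        gcongr
        exact le_mul_of_one_le_right (by positivity) h2s
  · have hN'0 : (0 : ℝ) < N' := one_pos.trans_le (one_le_of_mem_dyadic hN')
    have hNN' : (N : ℝ) = 2 * N' := by rw [h2]; push_cast; ring
    have hbest : ENNReal.ofReal ((N' : ℝ) ^ s) * bestError μ φ lam p f N' ≤ ENNReal.ofReal r :=
      (le_iSup₂ (f := fun (M : ℕ) (_ : M ∈ dyadic) =>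
        ENNReal.ofReal ((M : ℝ) ^ s) * bestError μ φ lam p f M) N' hN').trans
        (le_add_self.trans hfr)
    -- Dividing by the constant first reduces the infimum to one inequality per `g ∈ Π_{N/2}`,
    -- applied to `f - g` with `σ_N g = g`.
    have hle : (ENNReal.ofReal (1 + C))⁻¹ * eLpNorm (f - sigma φ lam H N f (ν N)) p μ ≤
        bestError μ φ lam p f N' := by
      refine le_iInf₂ fun g hg => ?_
      have hgc := hX.spectral.continuous_of_mem_diffPoly hg
      have hgm := hX.memLp_of_mem_diffPoly hg p
      have hrep : sigma φ lam H N g (ν N) = g :=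
        hX.spectral.sigma_eq_self hH hprod hN (hquad N hN) (by
          rw [hNN', mul_div_cancel_left₀ _ (by norm_num)]; exact hg)
      have e : f - sigma φ lam H N f (ν N) = (f - g) - sigma φ lam H N (f - g) (ν N) := by
        rw [hX.spectral.sigma_sub hH hN0 (hstab N hN f hfm hfc).1
          (hstab N hN g hgm fun _ => hgc).1, hrep]
        abel
      rw [e]
      have h3 := hbase (f - g) (hfm.sub hgm) fun h => (hfc h).sub hgc
      rw [ENNReal.inv_mul_le_iff (by simpa using by positivity) ENNReal.ofReal_ne_top]
      exact h3
    rw [ENNReal.inv_mul_le_iff (by simpa using by positivity) ENNReal.ofReal_ne_top] at hle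
    have hN's : 0 < (N' : ℝ) ^ s := by positivity
    have hbest' : bestError μ φ lam p f N' ≤ ENNReal.ofReal (r / (N' : ℝ) ^ s) := by
      rw [ENNReal.ofReal_div_of_pos hN's, ENNReal.le_div_iff_mul_le (by simp [hN's]) (by simp),
        mul_comm]
      exact hbest
    calc _ ≤ ENNReal.ofReal (1 + C) * ENNReal.ofReal (r / (N' : ℝ) ^ s) := hle.trans (by gcongr)
      _ = ENNReal.ofReal ((1 + C) * (r / (N' : ℝ) ^ s)) := (ENNReal.ofReal_mul (by positivity)).symm
      _ = _ := by
        congr 1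
        rw [hNN', Real.rpow_neg (by positivity), Real.mul_rpow (by norm_num) hN'0.le]
        field_simp

omit [TopologicalSpace X] [BorelSpace X] in
theorem sigmaQuantized_eq (S : ℝ) (N : ℕ)
    (f : X → ℝ) (μN νN : SignedMeasure X) (x : X) :
    sigmaQuantized φ lam H S N f μN νN x = (N : ℝ) ^ (-S) *
      sigma φ lam H ((2 * N : ℕ) : ℝ) (fun y => (quantized φ lam H S N f μN y : ℝ)) νN x := by
  unfold sigmaQuantized sigma
  push_cast
  rfl

/-- The error of quantization. -/
theorem IsDiffusionMeasureSpace.exists_abs_sigma_sub_sigmaQuantized_le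
    (hX : IsDiffusionMeasureSpace ρ μ φ lam α) (hH : IsLowPass H)
    {a : ℝ} (ha : 0 < a) (hprod : StrongProduct φ lam a) {q : ℝ≥0∞} (hq : 1 ≤ q) (hq' : q ≠ ⊤)
    {ν : ℕ → SignedMeasure X} (hν : IsUniformMZ μ φ lam a q ν)
    (hquad : ∀ N ∈ dyadic, IsQuadrature μ φ lam a (2 * N) (ν N)) (S : ℝ) :
    ∃ C > 0, ∀ N ∈ dyadic, ∀ (f : X → ℝ) (μN : SignedMeasure X) (x : X),
      |sigma φ lam H N f μN x - sigmaQuantized φ lam H S N f μN (ν N) x| ≤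
        C * (N : ℝ) ^ (-S) := by
  obtain ⟨C, hC, hK⟩ := hX.exists_lintegral_lowPassKernel_le hH ha hq hq' hν
  refine ⟨C, hC, fun N hN f μN x => ?_⟩
  obtain ⟨hfin, hKN⟩ := hK N hN
  have hN1 := one_le_of_mem_dyadic hN
  have hN0 : (0 : ℝ) < N := by linarith
  have h2N : (0 : ℝ) < ((2 * N : ℕ) : ℝ) := by push_cast; linarith
  set P := sigma φ lam H N f μN with hP
  have hPmem : P ∈ diffPoly φ lam N := hX.spectral.sigma_mem_diffPoly hH hN0 f μN
  -- Order `2N` of the quadrature is used here: `σ_{2N}` with respect to `ν_N` fixes `P ∈ Π_N`. The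
  -- error is then `σ_{2N}` of the rounding defect `P - Q`, which is at most `N ^ (-S)` everywhere.
  have hrep : sigma φ lam H ((2 * N : ℕ) : ℝ) P (ν N) = P :=
    hX.spectral.sigma_eq_self hH hprod (two_mul_mem_dyadic hN)
      (by have := hquad N hN; push_cast; exact this)
      (by push_cast; rw [mul_div_cancel_left₀ _ (by norm_num)]; exact hPmem)
  have hPm : Measurable P := (hX.spectral.continuous_of_mem_diffPoly hPmem).measurable
  obtain ⟨D, hD⟩ := hX.exists_abs_le_of_mem_diffPoly hPmem
  set Q : X → ℝ := fun y => (N : ℝ) ^ (-S) * (quantized φ lam H S N f μN y : ℝ) with hQ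
  have hNS : 0 < (N : ℝ) ^ (-S) := by positivity
  have hNS1 : (N : ℝ) ^ (-S) * (N : ℝ) ^ S = 1 := by
    rw [← Real.rpow_add hN0]; simp
  have hQm : Measurable Q := by
    refine Measurable.const_mul ?_ _
    exact (measurable_from_top (f := fun n : ℤ => (n : ℝ))).comp
      (Int.measurable_floor.comp (hPm.const_mul _))
  have he : ∀ y, |(P - Q) y| ≤ (N : ℝ) ^ (-S) := by
    intro y
    have e : (P - Q) y = (N : ℝ) ^ (-S) *
        ((N : ℝ) ^ S * P y - (⌊(N : ℝ) ^ S * P y⌋ : ℝ)) := by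
      simp only [Pi.sub_apply, hQ, quantized]
      rw [mul_sub, ← mul_assoc, hNS1, one_mul]
    rw [e, abs_mul, abs_of_pos hNS]
    refine mul_le_of_le_one_right hNS.le ?_
    rw [← Int.fract, abs_of_nonneg (Int.fract_nonneg _)]
    exact (Int.fract_lt_one _).le
  have hQb : ∀ y, |Q y| ≤ D + (N : ℝ) ^ (-S) := fun y => by
    have e : Q y = P y - (P - Q) y := by simp
    rw [e]
    exact (abs_sub _ _).trans (add_le_add (hD y) (he y))
  have hPi := fun k => hX.integrable_mul_phi (ν := (ν N).variation) hPm hD k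
  have hQi := fun k => hX.integrable_mul_phi (ν := (ν N).variation) hQm hQb k
  have hPQi := fun k => hX.integrable_mul_phi (ν := (ν N).variation) (hPm.sub hQm) he k
  have e : P x - sigmaQuantized φ lam H S N f μN (ν N) x =
      sigma φ lam H ((2 * N : ℕ) : ℝ) (P - Q) (ν N) x := by
    rw [hX.spectral.sigma_sub hH h2N hPi hQi, hrep, Pi.sub_apply,
      hX.spectral.sigma_const_mul hH h2N, sigmaQuantized_eq]
  rw [e, hX.spectral.sigma_eq_integral hH h2N hPQi, mul_comm C]
  refine abs_signedIntegral_mul_le hNS.le hC.le he ?_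
  have := (hKN x).2
  push_cast
  exact this

end DiffusionQuantization

/-! ### Counting bits. -/

namespace DiffusionQuantization

theorem intBits_le {n : ℤ} {x : ℝ} (hx : 1 ≤ x) (hn : |(n : ℝ)| ≤ x) :
    (intBits n : ℝ) ≤ 2 + Real.logb 2 x := by
  have hlog : 0 ≤ Real.logb 2 x := Real.logb_nonneg (by norm_num) hx
  unfold intBits
  push_cast
  rcases h : Nat.size n.natAbs with _ | j
  · push_cast; linarith
  -- With `j + 1` binary digits, `|n| ≥ 2 ^ j`; the sign bit and the leading digit account for the
  -- `2`.
  · have h1 : 2 ^ j ≤ n.natAbs := Nat.lt_size.1 (by omega)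
    have h2 : (2 : ℝ) ^ j ≤ x := by
      refine le_trans ?_ hn
      rw [← Int.cast_abs, Int.abs_eq_natAbs]
      exact_mod_cast h1
    have h3 : (j : ℝ) ≤ Real.logb 2 x := by
      rw [Real.le_logb_iff_rpow_le (by norm_num) (by linarith), Real.rpow_natCast]
      exact h2
    push_cast
    linarith

theorem bitCost_le {X : Type*} {T : Set X} (hT : T.Finite) {J : Set (X → ℤ)} {b : ℝ} (hb : 0 ≤ b)
    (h : ∀ I ∈ J, ∀ y ∈ T, (intBits (I y) : ℝ) ≤ b) :
    ((bitCost T J : ℕ∞) : ℝ≥0∞) ≤ ENNReal.ofReal (T.ncard * b) := by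
  have h1 : bitCost T J ≤ ((T.ncard * ⌊b⌋₊ : ℕ) : ℕ∞) := by
    unfold bitCost
    rw [← hT.cast_ncard_eq, Nat.cast_mul]
    gcongr
    refine iSup₂_le fun I hI => iSup₂_le fun y hy => ?_
    exact_mod_cast Nat.le_floor (h I hI y hy)
  calc ((bitCost T J : ℕ∞) : ℝ≥0∞) ≤ (((T.ncard * ⌊b⌋₊ : ℕ) : ℕ∞) : ℝ≥0∞) :=
        ENat.toENNReal_mono h1
    _ = ENNReal.ofReal ((T.ncard * ⌊b⌋₊ : ℕ) : ℝ) := by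
        rw [ENNReal.ofReal_natCast]; simp
    _ ≤ _ := by
        apply ENNReal.ofReal_le_ofReal
        push_cast
        gcongr
        exact Nat.floor_le hb

/-- Logarithms of powers of `N` are bounded by those of `N ^ s / c`. -/
theorem exists_two_add_logb_le {K E s c : ℝ} (hK : 1 ≤ K) (hE : 0 ≤ E) (hs : 0 < s) (hc : 0 < c) :
    ∃ D > 0, ∀ N : ℝ, 1 ≤ N → 1 ≤ N ^ s / c →
      2 + Real.logb 2 (K * N ^ E) ≤ D * (1 + Real.logb 2 (N ^ s / c)) := by
  have hKl : 0 ≤ Real.logb 2 K := Real.logb_nonneg (by norm_num) hK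
  -- `log N` equals `(log (N ^ s / c) + log c) / s`. All constants, including `|log c|`, are
  -- absorbed by the `1` in `1 + log (N ^ s / c)`.
  refine ⟨2 + Real.logb 2 K + E / s * |Real.logb 2 c| + E / s, by positivity, fun N hN hR => ?_⟩
  have hN0 : 0 < N := by linarith
  have hR' : 0 ≤ Real.logb 2 (N ^ s / c) := Real.logb_nonneg (by norm_num) hR
  have h1 : Real.logb 2 (N ^ s / c) = s * Real.logb 2 N - Real.logb 2 c := by
    rw [Real.logb_div (by positivity) hc.ne', Real.logb_rpow_eq_mul_logb_of_pos hN0]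
  have h2 : Real.logb 2 (K * N ^ E) = Real.logb 2 K + E * Real.logb 2 N := by
    rw [Real.logb_mul (by positivity) (by positivity), Real.logb_rpow_eq_mul_logb_of_pos hN0]
  have h3 : E * Real.logb 2 N = E / s * (Real.logb 2 (N ^ s / c) + Real.logb 2 c) := by
    rw [h1]; field_simp; ring
  have h4 : E / s * Real.logb 2 c ≤ E / s * |Real.logb 2 c| := by
    gcongr; exact le_abs_self _
  have h5 : 0 ≤ (2 + Real.logb 2 K + E / s * |Real.logb 2 c|) * Real.logb 2 (N ^ s / c) := by
    positivity
  have h6 : 0 ≤ E / s := by positivity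
  rw [h2, h3]
  nlinarith

end DiffusionQuantization

/-! ### The error bound and the bit count. -/

theorem theorem5p1 {X : Type*} [TopologicalSpace X] [MeasurableSpace X] [BorelSpace X]
    (ρ : X → X → ℝ) (μ : Measure X) [IsProbabilityMeasure μ]
    (φ : ℕ → X → ℝ) (lam : ℕ → ℝ) (α : ℝ)
    (hX : IsDiffusionMeasureSpace ρ μ φ lam α)
    (a : ℝ) (ha : 0 < a) (hprod : StrongProduct φ lam a)
    (H : ℝ → ℝ) (hH : IsLowPass H)
    (p : ℝ≥0∞) (hp : 1 ≤ p)
    -- the exponent of the Marcinkiewicz-Zygmund inequalities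
    (q : ℝ≥0∞) (hq : 1 ≤ q) (hq_top : q ≠ ∞)
    (μN νN : ℕ → SignedMeasure X)
    (hμ_top : p = ∞ → (∀ N ∈ dyadic, IsQuadrature μ φ lam a N (μN N)) ∧
      IsUniformMZ μ φ lam a q μN)
    (hμ_lt : p ≠ ∞ → ∀ N ∈ dyadic, μN N = μ.toSignedMeasure)
    (hν_quad : ∀ N ∈ dyadic, IsQuadrature μ φ lam a (2 * N) (νN N))
    (hν_mz : IsUniformMZ μ φ lam a q νN)
    (hν_supp : ∃ C : ℝ, ∀ N ∈ dyadic, (νN N).variation.support.Finite ∧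
      ((νN N).variation.support.ncard : ℝ) ≤ C * (N : ℝ) ^ α)
    (s S : ℝ) (hs : 0 < s) (hS : max 1 s < S)
    (r₀ : ℝ) (hr₀ : 0 < r₀) :
    ∃ c > (0 : ℝ), ∃ C > (0 : ℝ), ∀ r : ℝ, r₀ ≤ r → ∀ N ∈ dyadic,
      (∀ f ∈ sobolevBall μ φ lam s p r,
        eLpNorm (f - sigmaQuantized φ lam H S N f (μN N) (νN N)) p μ
          ≤ ENNReal.ofReal (c * r * (N : ℝ) ^ (-s))) ∧
      (∀ ε : ℝ, ε = c * r * (N : ℝ) ^ (-s) → ε ≤ 1 → ε ≤ r →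
        ((bitCost (νN N).variation.support
            ((fun f => quantized φ lam H S N f (μN N)) '' sobolevBall μ φ lam s p r) : ℕ∞) : ℝ≥0∞)
          ≤ ENNReal.ofReal (C * ((r / ε) ^ (α / s) * (1 + Real.logb 2 (r / ε))))) := by
  have hα := hX.alpha_pos
  have hsS : s < S := (le_max_right _ _).trans_lt hS
  have hμq : ∀ N ∈ dyadic, IsQuadrature μ φ lam a N (μN N) := fun N hN => by
    by_cases h : p = ∞
    · exact (hμ_top h).1 N hN
    · rw [hμ_lt h N hN]; exact isQuadrature_toSignedMeasure
  obtain ⟨C₁, hC₁, happrox⟩ := hX.exists_eLpNorm_sub_sigma_le hH ha hprod hq hq_top hp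
    (fun h => (hμ_top h).2) hμ_lt hμq hs
  obtain ⟨C₂, hC₂, hstab⟩ := hX.exists_eLpNorm_sigma_le hH ha hq hq_top hp
    (fun h => (hμ_top h).2) hμ_lt
  obtain ⟨C₃, hC₃, hquant⟩ := hX.exists_abs_sigma_sub_sigmaQuantized_le hH ha hprod hq hq_top hν_mz
    hν_quad S
  obtain ⟨C₄, hsupp⟩ := hν_supp
  -- The quantization error does not scale with `r`; writing `C₃ ≤ (C₃ / r₀) r` makes it do so,
  -- which is why `r` is kept away from `0`.
  set c := C₁ + C₃ / r₀ with hc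
  have hc0 : 0 < c := by positivity
  -- The integers are at most `N ^ S |σ_N f| + 1`, where `|σ_N f| ≤ C₂ N ^ α r` and `r ≤ N ^ s / c`;
  -- the final `1` covers rounding.
  set K := C₂ / c + 1 with hK
  have hK1 : 1 ≤ K := by
    have : 0 < C₂ / c := by positivity
    linarith
  obtain ⟨D, hD, hlog⟩ := exists_two_add_logb_le hK1
    (show 0 ≤ S + α + s by linarith) hs hc0
  refine ⟨c, hc0, (|C₄| + 1) * c ^ (α / s) * D, by positivity, fun r hr N hN => ⟨?_, ?_⟩⟩
  · intro f hf
    have hr0 : 0 < r := hr₀.trans_le hr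
    have hN1 := one_le_of_mem_dyadic hN
    have hN0 : (0 : ℝ) < N := by linarith
    have hfm := hf.1.aestronglyMeasurable
    have hσm : AEStronglyMeasurable (sigma φ lam H N f (μN N)) μ :=
      (hX.spectral.continuous_of_mem_diffPoly
        (hX.spectral.sigma_mem_diffPoly hH hN0 f (μN N))).measurable.aestronglyMeasurable
    have h2N : (0 : ℝ) < ((2 * N : ℕ) : ℝ) := by push_cast; linarith
    have hτm : AEStronglyMeasurable (sigmaQuantized φ lam H S N f (μN N) (νN N)) μ := by
      rw [show sigmaQuantized φ lam H S N f (μN N) (νN N) = _ from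
        funext fun x => sigmaQuantized_eq S N f (μN N) (νN N) x]
      exact ((hX.spectral.continuous_of_mem_diffPoly
        (hX.spectral.sigma_mem_diffPoly hH h2N _ (νN N))).const_mul _).measurable.aestronglyMeasurable
    have e : f - sigmaQuantized φ lam H S N f (μN N) (νN N) =
        (f - sigma φ lam H N f (μN N)) +
          (sigma φ lam H N f (μN N) - sigmaQuantized φ lam H S N f (μN N) (νN N)) := by abel
    have h2 : eLpNorm (sigma φ lam H N f (μN N) - sigmaQuantized φ lam H S N f (μN N) (νN N)) p μ ≤
        ENNReal.ofReal (C₃ * (N : ℝ) ^ (-S)) := by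
      refine (eLpNorm_le_of_ae_bound (C := C₃ * (N : ℝ) ^ (-S))
        (Eventually.of_forall fun x => hquant N hN f (μN N) x)).trans ?_
      simp
    rw [e]
    refine (eLpNorm_add_le (hfm.sub hσm) (hσm.sub hτm) hp).trans
      ((add_le_add (happrox r hr0.le N hN f hf) h2).trans ?_)
    rw [← ENNReal.ofReal_add (by positivity) (by positivity)]
    apply ENNReal.ofReal_le_ofReal
    have h3 : (N : ℝ) ^ (-S) ≤ (N : ℝ) ^ (-s) :=
      Real.rpow_le_rpow_of_exponent_le hN1 (by linarith)
    calc C₁ * r * (N : ℝ) ^ (-s) + C₃ * (N : ℝ) ^ (-S)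
        ≤ C₁ * r * (N : ℝ) ^ (-s) + C₃ * (r / r₀) * (N : ℝ) ^ (-s) := by
          gcongr
          exact le_mul_of_one_le_right hC₃.le ((one_le_div hr₀).2 hr)
      _ = _ := by rw [hc]; ring
  · intro ε hε hε1 hεr
    have hr0 : 0 < r := hr₀.trans_le hr
    have hN1 := one_le_of_mem_dyadic hN
    have hN0 : (0 : ℝ) < N := by linarith
    have hNs : 0 < (N : ℝ) ^ s := by positivity
    have hε0 : 0 < ε := by rw [hε]; positivity
    have hR : r / ε = (N : ℝ) ^ s / c := by
      rw [hε, Real.rpow_neg hN0.le]; field_simp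
    -- The condition `ε ≤ r` makes the logarithm nonnegative, while `ε ≤ 1` bounds `r` itself by a
    -- power of `N`; without the latter the word length would depend on `r`.
    have hR1 : 1 ≤ (N : ℝ) ^ s / c := by rw [← hR, one_le_div hε0]; exact hεr
    have hrN : r ≤ (N : ℝ) ^ s / c := by
      rw [← hR, le_div_iff₀ hε0]; exact mul_le_of_le_one_right hr0.le hε1
    have hlogR := hlog N hN1 hR1
    have hlog0 : 0 ≤ Real.logb 2 ((N : ℝ) ^ s / c) := Real.logb_nonneg (by norm_num) hR1
    rw [hR]
    refine (bitCost_le (hsupp N hN).1 (b := D * (1 + Real.logb 2 ((N : ℝ) ^ s / c))) (by positivity)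
      ?_).trans (ENNReal.ofReal_le_ofReal ?_)
    · rintro _ ⟨f, hf, rfl⟩ y -
      refine (intBits_le (x := K * (N : ℝ) ^ (S + α + s)) ?_ ?_).trans hlogR
      · exact one_le_mul_of_one_le_of_one_le hK1 (Real.one_le_rpow hN1 (by linarith))
      · have h1 := (hstab N hN f hf.1 hf.2.1).2.2 y
        have h2 : (eLpNorm f p μ).toReal ≤ r :=
          ENNReal.toReal_le_of_le_ofReal hr0.le (le_self_add.trans hf.2.2)
        set P := sigma φ lam H N f (μN N) y with hP
        have h3 : |P| ≤ C₂ * (N : ℝ) ^ α * ((N : ℝ) ^ s / c) := h1.trans (by gcongr; linarith)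
        have hNS : 0 < (N : ℝ) ^ S := by positivity
        have h4 : |((⌊(N : ℝ) ^ S * P⌋ : ℤ) : ℝ)| ≤ (N : ℝ) ^ S * |P| + 1 := by
          have e : ((⌊(N : ℝ) ^ S * P⌋ : ℤ) : ℝ) = (N : ℝ) ^ S * P - Int.fract ((N : ℝ) ^ S * P) := by
            rw [Int.fract]; ring
          rw [e]
          refine (abs_sub _ _).trans ?_
          rw [abs_mul, abs_of_pos hNS, abs_of_nonneg (Int.fract_nonneg ((N : ℝ) ^ S * P))]
          gcongr
          exact (Int.fract_lt_one _).le
        have h5 : 1 ≤ (N : ℝ) ^ (S + α + s) := Real.one_le_rpow hN1 (by linarith)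
        calc |((quantized φ lam H S N f (μN N) y : ℤ) : ℝ)|
            ≤ (N : ℝ) ^ S * |P| + 1 := h4
          _ ≤ (N : ℝ) ^ S * (C₂ * (N : ℝ) ^ α * ((N : ℝ) ^ s / c)) + (N : ℝ) ^ (S + α + s) := by
              gcongr
          _ = _ := by
              rw [hK, Real.rpow_add hN0, Real.rpow_add hN0]; ring
    · have hNα : (N : ℝ) ^ α = c ^ (α / s) * ((N : ℝ) ^ s / c) ^ (α / s) := by
        rw [← Real.mul_rpow hc0.le (by positivity), mul_div_cancel₀ _ hc0.ne', ← Real.rpow_mul hN0.le,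
          mul_div_cancel₀ _ hs.ne']
      calc _ ≤ (|C₄| + 1) * (N : ℝ) ^ α * (D * (1 + Real.logb 2 ((N : ℝ) ^ s / c))) := by
            gcongr
            refine (hsupp N hN).2.trans ?_
            gcongr
            linarith [le_abs_self C₄]
        _ = _ := by rw [hNα]; ring
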